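/- Let $k\ge 4$ be even and let $\mathbf a=(a_1,\dots,a_k)$ be integers with $a_1<a_2<\cdots<a_k$ which are symmetric, i.e. $a_1+a_k=a_2+a_{k-1}=\cdots=a_{k/2}+a_{k/2+1}$. A symmetrically colored $\mathbf a$-AP in a coloring of $[N]=\{1,\dots,N\}$ is a sequence $n+a_1d,\dots,n+a_kd$ of elements of $[N]$, with $n,d\in\mathbb Z$ and $d\neq 0$, such that $n+a_id$ and $n+a_{k+1-i}d$ have the same color for each $i=1,\dots,k/2$. For $f\colon\mathbb Z/N\mathbb Z\to\mathbb C$ and $s\ge 1$ let $\|f\|_{U^s}\ge 0$ be defined by $\|f\|_{U^s}^{2^s}=\mathbb E_{n,h_1,\dots,h_s\in\mathbb Z/N\mathbb Z}\,\partial_{h_1}\cdots\partial_{h_s}f(n)$, where $\partial_hf(n)=f(n)\overline{f(n-h)}$, and for $A\subseteq\mathbb Z/N\mathbb Z$ let $\Lambda_{\mathbf a}(1_A)=\mathbb E_{n,d\in\mathbb Z/N\mathbb Z}\prod_{i=1}^k1_A(n+a_id)$. For $0<\alpha<1$ let $\rho_{\mathbf a}(\alpha)$ be the largest real number $\rho$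 such that for every $\epsilon>0$ there exist $\eta>0$ and $N_0$ such that $\Lambda_{\mathbf a}(1_A)\ge\rho-\epsilon$ whenever $N\ge N_0$ and $A\subseteq\mathbb Z/N\mathbb Z$ satisfies $\|1_A-\alpha\|_{U^{k-2}}\le\eta$. **Theorem.** Suppose that there is a function $\delta$ with $\delta(N)\to0$ as $N\to\infty$ such that, for every $N\ge1$, there is a coloring of $[N]$ with at most $N^{\delta(N)}$ colors and no symmetrically colored $\mathbf a$-APs. Then for every $C>0$ there is $\alpha_0\in(0,1)$ such that for all $0<\alpha<\alpha_0$ the number $\rho_{\mathbf a}(\alpha)$ exists (the largest $\rho$ above is attained) and $\rho_{\mathbf a}(\alpha)<\alpha^C$. -/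

import Mathlib

open scoped BigOperators

namespace APDensity

section Group

variable {G : Type*} [AddCommGroup G] [Fintype G]

/-- The multiplicative derivative `∂_h f(n) = f(n) * conj (f(n - h))`. -/
noncomputable def mulDeriv (h : G) (f : G → ℂ) : G → ℂ :=
  fun n => f n * (starRingEnd ℂ) (f (n - h))

/-- The iterated derivative `∂_{h₁} ∂_{h₂} ⋯ ∂_{hₛ} f`. -/
noncomputable def iterMulDeriv {s : ℕ} (h : Fin s → G) (f : G → ℂ) : G → ℂ :=
  (List.ofFn h).foldr mulDeriv f

/-- The Gowers uniformity norm `‖f‖_{U^s}`, the `2^s`-th root of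
`𝔼_{n, h₁, …, hₛ} ∂_{h₁} ⋯ ∂_{hₛ} f(n)`; for `s ≥ 1` this average is a nonnegative real number,
so that passing to its real part changes nothing. -/
noncomputable def gowersNorm (s : ℕ) (f : G → ℂ) : ℝ :=
  ((𝔼 n : G, 𝔼 h : Fin s → G, iterMulDeriv h f n).re) ^ ((1 : ℝ) / 2 ^ s)

/-- `Λ_a(f₁, …, f_k) = 𝔼_{n, d} f₁(n + a₁ d) ⋯ f_k(n + a_k d)`. -/
noncomputable def Lambda {R : Type*} [CommSemiring R] [Module ℚ≥0 R] {k : ℕ}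
    (a : Fin k → ℤ) (f : Fin k → G → R) : R :=
  𝔼 n : G, 𝔼 d : G, ∏ i, f i (n + a i • d)

end Group

/-- The real numbers `ρ` such that for every `ε > 0` there are `η > 0` and `N₀` such that
`Λ_a(1_A) ≥ ρ - ε` for all `N ≥ N₀` and all `A ⊆ ℤ/Nℤ` with `‖1_A - α‖_{U^{k-2}} ≤ η`. -/
def admissible {k : ℕ} (a : Fin k → ℤ) (α : ℝ) : Set ℝ :=
  {ρ | ∀ ε : ℝ, 0 < ε → ∃ η : ℝ, 0 < η ∧ ∃ N₀ : ℕ, ∀ (N : ℕ) [NeZero N], N₀ ≤ N →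
    ∀ A : Set (ZMod N),
      gowersNorm (k - 2) (fun n => A.indicator (fun _ => (1 : ℂ)) n - (α : ℂ)) ≤ η →
      ρ - ε ≤ Lambda a (fun _ => A.indicator (fun _ => (1 : ℝ)))}

/-- `ρ_a(α)`, the largest element of `admissible a α`. -/
noncomputable def rho {k : ℕ} (a : Fin k → ℤ) (α : ℝ) : ℝ :=
  sSup (admissible a α)

/-- `a = (a₁, …, a_k)` is symmetric: `k` is even and `a₁ + a_k = a₂ + a_{k-1} = ⋯`. -/
def IsSymmetric {k : ℕ} (a : Fin k → ℤ) : Prop :=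
  Even k ∧ ∀ i j : Fin k, a i + a i.rev = a j + a j.rev

/-- The coloring `φ` of `[N] = {1, …, N}` has no symmetrically colored `a`-AP: there are no `n` and
`d ≠ 0` for which all `n + a_i d` lie in `[N]` and `n + a_i d` has the same color as
`n + a_{k+1-i} d` for every `i`. -/
def AvoidsSymmetric {k : ℕ} (a : Fin k → ℤ) {N : ℕ} {κ : Type*}
    (φ : Set.Icc (1 : ℤ) (N : ℤ) → κ) : Prop :=
  ¬ ∃ (n d : ℤ) (h : ∀ i, n + a i * d ∈ Set.Icc (1 : ℤ) (N : ℤ)), d ≠ 0 ∧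
    ∀ i : Fin k, φ ⟨n + a i * d, h i⟩ = φ ⟨n + a i.rev * d, h i.rev⟩

/-- There exist `N^{o(1)}`-colorings of `[N]` with no symmetrically colored `a`-APs: for some
`δ(N) → 0`, each `[N]` with `N ≥ 1` has such a coloring with at most `N^{δ(N)}` colors. -/
def HasFewColorings {k : ℕ} (a : Fin k → ℤ) : Prop :=
  ∃ δ : ℕ → ℝ, Filter.Tendsto δ Filter.atTop (nhds 0) ∧
    ∀ N : ℕ, 1 ≤ N → ∃ r : ℕ, (r : ℝ) ≤ (N : ℝ) ^ δ N ∧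
      ∃ φ : Set.Icc (1 : ℤ) (N : ℤ) → Fin r, AvoidsSymmetric a φ

end APDensity

namespace APDensity

/-! ### Lifting residues to integers after cutting the circle -/

section Lift

/-! For small `α` one constructs, in cyclic groups of arbitrarily large order, `U^{k-2}`-uniform
sets of density about `α` with at most an `α^C / 2` proportion of `a`-APs. Work in `ℤ/(MQp)` with
`M`, `Q` fixed and `p` a large prime, and let `A` consist of the `x` for which `x^(k-2) - V (col x)`
lies in `[0, αp)` modulo `p`, where `col` colors residues modulo `MQ` and `V` assigns a shift in
`ℤ/pℤ` to each color.

`A` is uniform because a phase of degree exactly `k - 2` has small `U^{k-2}` correlations: `k - 3`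
Cauchy–Schwarz steps leave a nonconstant linear phase, which averages to zero
(`norm_phaseAverage_le`). The shift depends only on the residue modulo `MQ` and does no harm
(`norm_gowersAverage_le`).

`A` has few `a`-APs because values of degree `k - 2` at `n + a_i d` satisfy a linear relation with
nonzero coefficients `C_i` (`exists_relation`). An `a`-AP in `A` therefore puts the sum of `C_i
V(color_i)` within `O(αp)` of zero. When some color of the pattern occurs exactly once, this is an
event of probability `O(α)` for random `V`, so a union bound over patterns finds a good `V` once the
`k`-th power of the number of colors is small compared with `1/α` (`exists_shift`).

It remains to find a coloring in which every `a`-AP has an unrepeated color unless `d` vanishes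
modulo `M` or `Q` (`exists_coloring_unique`). These exceptions cost `1/M + 1/Q`, so the group must
be a large power of the number of colors. On `ℤ/Qℤ` a Behrend-type coloring makes all equally
colored pairs of an `a`-AP share a midpoint (`exists_midpoint_coloring`). If every color is
repeated, this forces the pattern to be symmetric under reversal, and the hypothesized coloring,
transferred to `ℤ/Mℤ` (`exists_cyclic_coloring`), excludes that. -/

lemma eq_zero_of_natCast_mul_eq_zero {q B : ℕ} (hB : Nat.Coprime B q) {d : ZMod q}
    (h : (B : ZMod q) * d = 0) : d = 0 :=
  ((ZMod.isUnit_iff_coprime B q).mpr hB).mul_right_eq_zero.mp h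

/-- The residue `z` modulo `q` lies within distance `W` of zero. -/
def NearZero {q : ℕ} (W : ℕ) (z : ZMod q) : Prop := z.val ≤ W ∨ q ≤ z.val + W

variable {q : ℕ} [NeZero q]

lemma val_add_intCast {W : ℕ} {z : ZMod q} (hz : ¬ NearZero W z) {e : ℤ} (he : |e| ≤ W) :
    ((z + (e : ZMod q)).val : ℤ) = z.val + e := by
  unfold NearZero at hz
  push Not at hz
  have h : z + (e : ZMod q) = (((z.val : ℤ) + e : ℤ) : ZMod q) := by
    push_cast
    rw [ZMod.natCast_zmod_val]
  have := abs_le.mp he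
  rw [h, ZMod.val_intCast, Int.emod_eq_of_lt] <;> omega

lemma NearZero.exists_int {W : ℕ} {z : ZMod q} (hz : NearZero W z) :
    ∃ e : ℤ, |e| ≤ W ∧ z = (e : ZMod q) := by
  have hlt := ZMod.val_lt z
  rcases hz with h | h
  · refine ⟨z.val, abs_le.mpr (by omega), ?_⟩
    rw [Int.cast_natCast, ZMod.natCast_zmod_val]
  · refine ⟨(z.val : ℤ) - q, abs_le.mpr (by omega), ?_⟩
    push_cast
    rw [ZMod.natCast_zmod_val, ZMod.natCast_self, sub_zero]

/-- A residue is close to at most one of the cuts `0, ⌊q/T⌋, 2⌊q/T⌋, …, (T - 1)⌊q/T⌋`. -/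
lemma nearZero_cut_unique {W T : ℕ} (hW : 2 * W < q / T) {t t' : Fin T} {z : ZMod q}
    (h : NearZero W (z - ((t * (q / T) : ℕ) : ZMod q)))
    (h' : NearZero W (z - ((t' * (q / T) : ℕ) : ZMod q))) : t = t' := by
  by_contra hne
  wlog hlt : t < t' generalizing t t'
  · exact this h' h (Ne.symm hne) (lt_of_le_of_ne (not_lt.mp hlt) (Ne.symm hne))
  obtain ⟨e, he, hez⟩ := h.exists_int
  obtain ⟨e', he', hez'⟩ := h'.exists_int
  set g := q / T with hg
  have hgq : T * g ≤ q := Nat.mul_div_le q T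
  have hdvd : (q : ℤ) ∣ ((t' : ℕ) * g : ℕ) - ((t : ℕ) * g : ℕ) - (e - e') := by
    rw [← ZMod.intCast_zmod_eq_zero_iff_dvd]
    push_cast at hez hez' ⊢
    rw [← hez, ← hez']
    ring
  have h1 : (t : ℕ) * g + g ≤ t' * g := by
    rw [← Nat.succ_mul]
    exact Nat.mul_le_mul_right _ hlt
  have h2 : (t' : ℕ) * g + g ≤ T * g := by
    rw [← Nat.succ_mul]
    exact Nat.mul_le_mul_right _ t'.2
  have := abs_le.mp he
  have := abs_le.mp he'
  have h3 := Int.le_of_dvd (by omega) hdvd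
  omega

/-- A partition of `ℤ/qℤ` into few short intervals. -/
lemma exists_arc {L : ℕ} (hL : 0 < L) (hq : L ≤ q) :
    ∃ arc : ZMod q → Fin (2 * L), ∀ x y, arc x = arc y →
      |(x.val : ℤ) - y.val| ≤ (q / L : ℕ) := by
  have hw : 0 < q / L := Nat.div_pos hq hL
  refine ⟨fun x => ⟨x.val / (q / L), ?_⟩, fun x y hxy => ?_⟩
  · rw [Nat.div_lt_iff_lt_mul hw]
    have h1 := Nat.lt_mul_div_succ q hL
    have h2 : L * (q / L + 1) ≤ 2 * L * (q / L) := by nlinarith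
    exact (ZMod.val_lt x).trans_le (h1.le.trans h2)
  · have h := congrArg Fin.val hxy
    simp only at h
    have hx := Nat.div_add_mod x.val (q / L)
    have hy := Nat.div_add_mod y.val (q / L)
    have hx' := Nat.mod_lt x.val hw
    have hy' := Nat.mod_lt y.val hw
    rw [h] at hx
    rw [abs_le]
    constructor <;> omega

lemma eq_add_intCast_val_sub (x y : ZMod q) : x = y + (((x.val : ℤ) - y.val : ℤ) : ZMod q) := by
  push_cast
  rw [ZMod.natCast_zmod_val, ZMod.natCast_zmod_val]
  ring

end Lift

/-! ### Transferring the given coloring to a cyclic group -/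

section SymmetricColoring

/-- A coloring of `[M]` without symmetrically colored `a`-APs yields one of `ℤ/Mℤ`. -/
lemma exists_cyclic_coloring {k : ℕ} [NeZero k] {a : Fin k → ℤ} (ha : StrictMono a) {b : ℕ}
    (hb : (b : ℤ) = a (Fin.rev 0) - a 0) (hb0 : 0 < b) {M : ℕ} [NeZero M] (hM : 8 * b ≤ M)
    (hcop : Nat.Coprime b M) {r : ℕ} (φ : Set.Icc (1 : ℤ) (M : ℤ) → Fin r)
    (hφ : AvoidsSymmetric a φ) :
    ∃ c : ZMod M → Fin (2 * (8 * b)) × (Fin 2 → Fin r), ∀ n d : ZMod M,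
      (∀ i, c (n + (a i : ZMod M) * d) = c (n + (a i.rev : ZMod M) * d)) → d = 0 := by
  obtain ⟨arc, harc⟩ := exists_arc (q := M) (L := 8 * b) (by omega) hM
  set w := M / (8 * b) with hw
  have hwpos : 0 < w := Nat.div_pos hM (by omega)
  have hcut : 2 * (b * w) < M / 2 := by
    have h1 : 8 * b * w ≤ M := Nat.mul_div_le M (8 * b)
    have h2 : 0 < b * w := by positivity
    have h3 : 8 * (b * w) ≤ M := by linarith
    omega
  -- Equal arcs at the two endpoints bound `b * d`, not `d`; multiplying by `b` turns the
  -- progression into one with small integer steps.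
  let lift : Fin 2 → ZMod M → ZMod M := fun t x => (b : ZMod M) * x - ((t * (M / 2) : ℕ) : ZMod M)
  have hmem : ∀ z : ZMod M, (z.val : ℤ) + 1 ∈ Set.Icc (1 : ℤ) (M : ℤ) := fun z =>
    ⟨by omega, by have := ZMod.val_lt z; omega⟩
  refine ⟨fun x => (arc x, fun t => φ ⟨((lift t x).val : ℤ) + 1, hmem _⟩), fun n d hsym => ?_⟩
  set X : Fin k → ZMod M := fun i => n + a i * d with hX
  have hsym0 := hsym (Fin.rev 0)
  simp only [Prod.mk.injEq, Fin.rev_rev] at hsym0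
  have hsmall := harc _ _ hsym0.1
  set e : ℤ := ((X (Fin.rev 0)).val : ℤ) - (X 0).val with he
  have hbd : (b : ZMod M) * d = e := by
    have h := eq_add_intCast_val_sub (X (Fin.rev 0)) (X 0)
    rw [← he] at h
    simp only [hX] at h
    have hb' : (b : ZMod M) = a (Fin.rev 0) - a 0 := by
      rw [← Int.cast_sub, ← hb, Int.cast_natCast]
    rw [hb']
    linear_combination h
  -- The two cuts are too far apart for `b * X 0` to be near both, so one of them does not separate
  -- the progression.
  obtain ⟨t, ht⟩ : ∃ t : Fin 2, ¬ NearZero (b * w) (lift t (X 0)) := by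
    by_contra! hall
    have := nearZero_cut_unique hcut (hall 0) (hall 1)
    exact absurd this (by decide)
  have hlin : ∀ i, ((lift t (X i)).val : ℤ) = (lift t (X 0)).val + (a i - a 0) * e := by
    intro i
    have h1 : lift t (X i) = lift t (X 0) + (((a i - a 0) * e : ℤ) : ZMod M) := by
      simp only [lift, hX]
      push_cast
      rw [← hbd]
      ring
    rw [h1]
    refine val_add_intCast ht ?_
    rw [abs_mul]
    push_cast
    refine mul_le_mul ?_ hsmall (abs_nonneg _) (by positivity)
    have h2 : a 0 ≤ a i := ha.monotone (Fin.zero_le i)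
    have h3 : a i ≤ a (Fin.rev 0) := ha.monotone (by
      rw [← Fin.rev_le_rev, Fin.rev_rev]; exact Fin.zero_le _)
    rw [abs_of_nonneg (by omega)]
    omega
  have he0 : e = 0 := by
    by_contra hne
    have hval : ∀ i, ((lift t (X 0)).val : ℤ) + 1 - a 0 * e + a i * e
        = ((lift t (X i)).val : ℤ) + 1 := fun i => by rw [hlin i]; ring
    refine hφ ⟨(lift t (X 0)).val + 1 - a 0 * e, e, fun i => ?_, hne, fun i => ?_⟩
    · rw [hval]; exact hmem _
    · have h1 := congrFun (congrArg Prod.snd (hsym i)) t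
      simp only [hval]
      exact h1
  rw [he0, Int.cast_zero] at hbd
  exact eq_zero_of_natCast_mul_eq_zero hcop hbd

end SymmetricColoring

/-! ### A Behrend-type coloring of a product of cyclic groups -/

section Behrend

/-- Colors for `exists_midpoint_coloring`. -/
abbrev MidpointColor (D L T qmax : ℕ) : Type :=
  (Fin D → Fin (2 * L)) × Fin T ×
    (Σ J : {J : Finset (Fin D) // J.card * T ≤ D}, (J.1 → Fin qmax)) ×
    (Fin T → Fin (D * qmax ^ 2 + 1))

/-- Exact residues are recorded on at most `D / T` coordinates, so they cost only `qmax ^ (D / T)`,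
and choosing these coordinates costs at most `2 ^ D`. -/
lemma card_midpointColor_le (D L T qmax : ℕ) (hT : 0 < T) (hq : 0 < qmax) :
    Fintype.card (MidpointColor D L T qmax) ≤
      (2 * L) ^ D * (T * ((2 ^ D * qmax ^ (D / T)) * (D * qmax ^ 2 + 1) ^ T)) := by
  simp only [Fintype.card_prod, Fintype.card_pi, Fintype.card_fin, Finset.prod_const,
    Finset.card_univ, Fintype.card_sigma]
  gcongr
  calc ∑ J : {J : Finset (Fin D) // J.card * T ≤ D}, qmax ^ Fintype.card J.1
      ≤ ∑ J : {J : Finset (Fin D) // J.card * T ≤ D}, qmax ^ (D / T) := by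
        refine Finset.sum_le_sum fun J _ => Nat.pow_le_pow_right hq ?_
        rw [Fintype.card_coe, Nat.le_div_iff_mul_le hT]
        exact J.2
    _ ≤ 2 ^ D * qmax ^ (D / T) := by
        rw [Finset.sum_const, smul_eq_mul, Finset.card_univ]
        gcongr
        calc _ ≤ Fintype.card (Finset (Fin D)) := Fintype.card_subtype_le _
          _ = 2 ^ D := by simp

/-- A quadratic with positive leading coefficient takes each value at most twice, and pairs of
points with equal values have the same midpoint. -/
lemma add_eq_add_of_quadratic {u s : ℤ} (hs : s ≠ 0) {x x' y y' : ℤ} (hx : x ≠ x') (hy : y ≠ y')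
    (h₁ : 2 * x * u + x ^ 2 * s = 2 * x' * u + x' ^ 2 * s)
    (h₂ : 2 * y * u + y ^ 2 * s = 2 * y' * u + y' ^ 2 * s) : x + x' = y + y' := by
  have e₁ : 2 * u + (x + x') * s = 0 := by
    have : (x - x') * (2 * u + (x + x') * s) = 0 := by linear_combination h₁
    exact (mul_eq_zero.mp this).resolve_left (sub_ne_zero.mpr hx)
  have e₂ : 2 * u + (y + y') * s = 0 := by
    have : (y - y') * (2 * u + (y + y') * s) = 0 := by linear_combination h₂
    exact (mul_eq_zero.mp this).resolve_left (sub_ne_zero.mpr hy)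
  exact mul_right_cancel₀ hs (by linear_combination e₁ - e₂)

/-- A Behrend-type coloring of `∏ ℤ/q_jℤ`: in a nontrivial `a`-AP all pairs of points of the same
color have the same midpoint. -/
lemma exists_midpoint_coloring {k : ℕ} (a : Fin k → ℤ) {B E T : ℕ} (hB : 0 < B) (hE : 0 < E)
    (hT : 0 < T) (haB : ∀ i j, i ≠ j → (a i - a j) ∣ (B : ℤ)) (haE : ∀ i j, |a i - a j| ≤ E)
    {D qmax : ℕ} (q : Fin D → ℕ) [∀ j, NeZero (q j)] (hq : ∀ j, 4 * E * B * T ≤ q j)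
    (hqmax : ∀ j, q j ≤ qmax) (hcop : ∀ j, Nat.Coprime B (q j)) :
    ∃ c : (∀ j, ZMod (q j)) → MidpointColor D (4 * E * B * T) T qmax,
      ∀ n d : ∀ j, ZMod (q j), d ≠ 0 → ∀ i i' l l' : Fin k, a i ≠ a i' → a l ≠ a l' →
        c (fun j => n j + a i * d j) = c (fun j => n j + a i' * d j) →
        c (fun j => n j + a l * d j) = c (fun j => n j + a l' * d j) →
        a i + a i' = a l + a l' := by
  classical
  have hL : 0 < 4 * E * B * T := by positivity
  choose arc harc using fun j => exists_arc (q := q j) hL (hq j)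
  set w : Fin D → ℕ := fun j => q j / (4 * E * B * T) with hw
  have hwpos : ∀ j, 0 < w j := fun j => Nat.div_pos (hq j) hL
  set W : Fin D → ℕ := fun j => E * (B * w j) with hW
  have hcut : ∀ j, 2 * W j < q j / T := by
    intro j
    have h1 : 4 * E * B * T * w j ≤ q j := Nat.mul_div_le _ _
    have h2 : 4 * W j ≤ q j / T := by
      rw [Nat.le_div_iff_mul_le hT]
      calc 4 * (E * (B * w j)) * T = 4 * E * B * T * w j := by ring
        _ ≤ q j := h1
    have h3 : 0 < W j := Nat.mul_pos hE (Nat.mul_pos hB (hwpos j))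
    omega
  let lift : Fin T → ∀ j, ZMod (q j) → ZMod (q j) := fun t j x =>
    (B : ZMod (q j)) * x - ((t * (q j / T) : ℕ) : ZMod (q j))
  let near : Fin T → (∀ j, ZMod (q j)) → Finset (Fin D) := fun t x =>
    Finset.univ.filter fun j => NearZero (W j) (lift t j (x j))
  -- Pigeonhole: each coordinate is near at most one of the `T` cuts, so some cut is near at most `D
  -- / T` coordinates.
  have hex : ∀ x, ∃ t, (near t x).card * T ≤ D := by
    intro x
    by_contra! hlt
    have h1 : ∑ t, (near t x).card ≤ D := by
      simp only [near, Finset.card_filter]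
      rw [Finset.sum_comm]
      calc _ ≤ ∑ j : Fin D, 1 := by
            refine Finset.sum_le_sum fun j _ => ?_
            rw [← Finset.card_filter]
            refine Finset.card_le_one.mpr fun t ht t' ht' => ?_
            exact nearZero_cut_unique (hcut j) (Finset.mem_filter.mp ht).2
              (Finset.mem_filter.mp ht').2
        _ = D := by simp
    have h2 : T * D < ∑ t, (near t x).card * T := by
      calc T * D = ∑ t : Fin T, D := by simp
        _ < _ := Finset.sum_lt_sum_of_nonempty ⟨⟨0, hT⟩, Finset.mem_univ _⟩ fun t _ => hlt t
    rw [← Finset.sum_mul] at h2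
    have := Nat.mul_le_mul_right T h1
    linarith [mul_comm T D]
  choose τ hτ using hex
  have hbound : ∀ (t : Fin T) (x : ∀ j, ZMod (q j)),
      ∑ j, (lift t j (x j)).val ^ 2 < D * qmax ^ 2 + 1 := by
    intro t x
    rw [Nat.lt_succ_iff]
    calc _ ≤ ∑ j : Fin D, qmax ^ 2 := Finset.sum_le_sum fun j _ =>
          Nat.pow_le_pow_left ((ZMod.val_lt _).le.trans (hqmax j)) 2
      _ = _ := by simp
  let c : (∀ j, ZMod (q j)) → MidpointColor D (4 * E * B * T) T qmax := fun x =>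
    (fun j => arc j (x j), τ x,
      ⟨⟨near (τ x) x, hτ x⟩, fun j => ⟨(x j.1).val, (ZMod.val_lt _).trans_le (hqmax _)⟩⟩,
      fun t => ⟨∑ j, (lift t j (x j)).val ^ 2, hbound t x⟩)
  refine ⟨c, fun n d hd i i' l l' hi hl hci hcl => ?_⟩
  set X : Fin k → ∀ j, ZMod (q j) := fun i j => n j + a i * d j with hX
  change c (X i) = c (X i') at hci
  change c (X l) = c (X l') at hcl
  have hii : i ≠ i' := fun h => hi (by rw [h])
  obtain ⟨g, hg⟩ := haB i i' hii
  have hgB : |g| ≤ B := by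
    have h1 : |a i - a i'| * |g| = B := by rw [← abs_mul, ← hg]; simp
    have h2 : 1 ≤ |a i - a i'| := Int.one_le_abs (sub_ne_zero.mpr hi)
    nlinarith [abs_nonneg g]
  simp only [c, Prod.mk.injEq] at hci hcl
  obtain ⟨harci, hτi, hexact, hF⟩ := hci
  -- The sums of squares are recorded for every cut, so the second pair can be tested at the cut
  -- chosen by the first.
  have hF' := hcl.2.2.2
  let e : Fin D → ℤ := fun j => ((X i j).val : ℤ) - (X i' j).val
  have he : ∀ j, |e j| ≤ w j := fun j => harc j _ _ (congrFun harci j)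
  have had : ∀ j, ((a i - a i' : ℤ) : ZMod (q j)) * d j = e j := by
    intro j
    have h := eq_add_intCast_val_sub (X i j) (X i' j)
    simp only [hX] at h
    push_cast
    simp only [e, hX]
    linear_combination h
  have hBd : ∀ j, (B : ZMod (q j)) * d j = ((g * e j : ℤ) : ZMod (q j)) := by
    intro j
    have h1 : (B : ZMod (q j)) = ((a i - a i' : ℤ) : ZMod (q j)) * (g : ZMod (q j)) := by
      rw [← Int.cast_mul, ← hg, Int.cast_natCast]
    rw [h1]
    push_cast
    rw [← had j]
    push_cast
    ring
  set δ : Fin D → ℤ := fun j => g * e j with hδ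
  have hδ0 : ∀ j, δ j = 0 → d j = 0 := by
    intro j hj
    refine eq_zero_of_natCast_mul_eq_zero (hcop j) ?_
    rw [hBd j]
    simp only [hδ] at hj
    rw [hj, Int.cast_zero]
  -- Coordinates too close to the cut to be lifted have their exact residues in the color, hence do
  -- not move between the two points.
  have hmem : ∀ j, j ∈ near (τ (X i)) (X i) → e j = 0 := by
    intro j hj
    have h1 := Sigma.mk.inj_iff.mp hexact
    obtain ⟨h2, h3⟩ := h1
    have h4 : ∀ (J J' : {J : Finset (Fin D) // J.card * T ≤ D}) (f : J.1 → Fin qmax)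
        (f' : J'.1 → Fin qmax), J = J' → f ≍ f' → ∀ (h : j ∈ J.1) (h' : j ∈ J'.1),
        f ⟨j, h⟩ = f' ⟨j, h'⟩ := by
      rintro J J' f f' rfl hff h h'
      rw [eq_of_heq hff]
    have hj' : j ∈ near (τ (X i')) (X i') := by
      have := congrArg Subtype.val h2
      simp only at this
      rwa [← this]
    have h5 := congrArg Fin.val (h4 _ _ _ _ h2 h3 hj hj')
    simp only at h5
    simp only [e]
    omega
  set t := τ (X i) with ht
  have hlin : ∀ m j, ((lift t j (X m j)).val : ℤ) = (lift t j (X i j)).val + (a m - a i) * δ j := by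
    intro m j
    have h1 : lift t j (X m j) = lift t j (X i j) + (((a m - a i) * δ j : ℤ) : ZMod (q j)) := by
      simp only [lift, hX]
      push_cast
      have := hBd j
      push_cast at this
      simp only [hδ]
      push_cast
      linear_combination (a m - a i : ZMod (q j)) * this
    rw [h1]
    by_cases hj : j ∈ near t (X i)
    · simp [hδ, hmem j hj]
    · refine val_add_intCast (W := W j) (fun h => hj ?_) ?_
      · simpa [near] using h
      · simp only [hδ, hW]
        rw [abs_mul, abs_mul]
        push_cast
        have := he j
        gcongr
        exact haE m i
  -- With integer lifts `V j + a m * δ j`, the sum of squares is a quadratic in `a m` with leading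
  -- coefficient `∑ δ j ^ 2`, positive since `d ≠ 0`.
  set V : Fin D → ℤ := fun j => (lift t j (X i j)).val - a i * δ j with hV
  have hquad : ∀ m, ((∑ j, (lift t j (X m j)).val ^ 2 : ℕ) : ℤ) =
      ∑ j, V j ^ 2 + (2 * a m * ∑ j, V j * δ j + a m ^ 2 * ∑ j, δ j ^ 2) := by
    intro m
    push_cast
    rw [Finset.mul_sum, Finset.mul_sum, ← Finset.sum_add_distrib, ← Finset.sum_add_distrib]
    refine Finset.sum_congr rfl fun j _ => ?_
    rw [hlin m j]
    simp only [hV]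
    ring
  have hsum : ∑ j, δ j ^ 2 ≠ 0 := by
    intro h0
    apply hd
    funext j
    have := (Finset.sum_eq_zero_iff_of_nonneg (fun j _ => sq_nonneg (δ j))).mp h0 j
      (Finset.mem_univ j)
    exact hδ0 j (pow_eq_zero_iff (two_ne_zero)|>.mp this)
  have hFi : ∑ j, (lift t j (X i j)).val ^ 2 = ∑ j, (lift t j (X i' j)).val ^ 2 :=
    congrArg Fin.val (congrFun hF t)
  have hFl : ∑ j, (lift t j (X l j)).val ^ 2 = ∑ j, (lift t j (X l' j)).val ^ 2 :=
    congrArg Fin.val (congrFun hF' t)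
  have hFi' := congrArg (Nat.cast : ℕ → ℤ) hFi
  have hFl' := congrArg (Nat.cast : ℕ → ℤ) hFl
  rw [hquad, hquad, add_right_inj] at hFi' hFl'
  exact add_eq_add_of_quadratic hsum hi hl hFi' hFl'

end Behrend

/-! ### From common midpoints to an unrepeated color -/

section UniqueColor

/-- If every color occurs at least twice and equal colors force equal midpoints, then the coloring
is symmetric. -/
lemma symmetric_of_midpoints {k : ℕ} [NeZero k] {a : Fin k → ℤ} (ha : StrictMono a)
    (hs : IsSymmetric a) {κ : Type*} (f : Fin k → κ) (hrep : ∀ i, ∃ l, l ≠ i ∧ f l = f i)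
    (hmid : ∀ i i' l l', a i ≠ a i' → a l ≠ a l' → f i = f i' → f l = f l' →
      a i + a i' = a l + a l') : ∀ i, f i = f i.rev := by
  choose π hπ hfπ using hrep
  have hne : ∀ i, a i ≠ a (π i) := fun i h => hπ i (ha.injective h).symm
  have hsum : ∀ i l, a i + a (π i) = a l + a (π l) := fun i l =>
    hmid _ _ _ _ (hne i) (hne l) (hfπ i).symm (hfπ l).symm
  have hlo : ∀ i, a 0 ≤ a i := fun i => ha.monotone (Fin.zero_le i)
  have hhi : ∀ i, a i ≤ a (Fin.rev 0) := fun i => ha.monotone (by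
    rw [← Fin.rev_le_rev, Fin.rev_rev]; exact Fin.zero_le _)
  intro i
  -- The common pair sum is at most `a 0 + a (rev 0)` when read from the smallest term and at least
  -- this when read from the largest. So it equals that value, and each partner is the reflection.
  have h1 := hsum 0 (Fin.rev 0)
  have h2 := hhi (π 0)
  have h3 := hlo (π (Fin.rev 0))
  have h4 := hsum i 0
  have h5 := hs.2 i 0
  have h6 : π i = i.rev := ha.injective (by linarith)
  rw [← h6, hfπ]

end UniqueColor

section Product

lemma castHom_eq_zero_iff {m n : ℕ} [NeZero n] (h : m ∣ n) (x : ZMod n) :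
    ZMod.castHom h (ZMod m) x = 0 ↔ m ∣ x.val := by
  rw [ZMod.castHom_apply, ZMod.cast_eq_val, ZMod.natCast_eq_zero_iff]

/-- The coloring of a product of cyclic groups in which every nondegenerate `a`-AP has a point
whose color is not repeated. -/
lemma exists_coloring_unique {k : ℕ} [NeZero k] {a : Fin k → ℤ} (ha : StrictMono a)
    (hs : IsSymmetric a) {b : ℕ} (hb : (b : ℤ) = a (Fin.rev 0) - a 0) (hb0 : 0 < b)
    {B T : ℕ} (hB : 0 < B) (hT : 0 < T) (haB : ∀ i j, i ≠ j → (a i - a j) ∣ (B : ℤ))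
    (hbB : b ∣ B) {M : ℕ} [NeZero M] (hM : 8 * b ≤ M) (hcopM : Nat.Coprime B M)
    {r : ℕ} (φ : Set.Icc (1 : ℤ) (M : ℤ) → Fin r) (hφ : AvoidsSymmetric a φ)
    {D qmax : ℕ} (q : Fin D → ℕ) (hq : ∀ j, 4 * b * B * T ≤ q j) (hqmax : ∀ j, q j ≤ qmax)
    (hcop : ∀ j, Nat.Coprime B (q j)) (hpair : Pairwise fun i j => Nat.Coprime (q i) (q j)) :
    ∃ c : ZMod (M * ∏ j, q j) →
        (Fin (2 * (8 * b)) × (Fin 2 → Fin r)) × MidpointColor D (4 * b * B * T) T qmax,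
      ∀ n d : ZMod (M * ∏ j, q j),
        ZMod.castHom (Dvd.intro _ rfl) (ZMod M) d ≠ 0 →
        ZMod.castHom (Dvd.intro_left M rfl) (ZMod (∏ j, q j)) d ≠ 0 →
        ∃ i, ∀ l, l ≠ i → c (n + a l • d) ≠ c (n + a i • d) := by
  have hpos : ∀ j, 0 < q j := fun j => lt_of_lt_of_le (by positivity) (hq j)
  have : ∀ j, NeZero (q j) := fun j => ⟨(hpos j).ne'⟩
  have : NeZero (∏ j, q j) := ⟨Finset.prod_ne_zero_iff.mpr fun j _ => (hpos j).ne'⟩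
  have hlo : ∀ i, a 0 ≤ a i := fun i => ha.monotone (Fin.zero_le i)
  have hhi : ∀ i, a i ≤ a (Fin.rev 0) := fun i => ha.monotone (by
    rw [← Fin.rev_le_rev, Fin.rev_rev]; exact Fin.zero_le _)
  obtain ⟨c₁, hc₁⟩ := exists_cyclic_coloring ha hb hb0 hM
    (Nat.Coprime.coprime_dvd_left hbB hcopM) φ hφ
  obtain ⟨c₂, hc₂⟩ := exists_midpoint_coloring a hB hb0 hT haB
    (fun i j => by
      have := hlo i; have := hlo j; have := hhi i; have := hhi j
      rw [abs_le]; constructor <;> omega) q hq hqmax hcop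
  have hdvd : ∀ j, q j ∣ M * ∏ j, q j := fun j =>
    (Finset.dvd_prod_of_mem q (Finset.mem_univ j)).trans (Dvd.intro_left M rfl)
  refine ⟨fun x => (c₁ (ZMod.castHom (Dvd.intro _ rfl) (ZMod M) x),
    c₂ fun j => ZMod.castHom (hdvd j) (ZMod (q j)) x), fun n d hdM hdQ => ?_⟩
  by_contra! hall
  have hd : (fun j => ZMod.castHom (hdvd j) (ZMod (q j)) d) ≠ 0 := by
    intro h0
    apply hdQ
    rw [castHom_eq_zero_iff]
    refine Finset.prod_dvd_of_isRelPrime ?_ fun j _ => ?_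
    · intro i _ j _ hij
      exact Nat.coprime_iff_isRelPrime.mp (hpair hij)
    · exact (castHom_eq_zero_iff _ _).mp (congrFun h0 j)
  refine hdM (hc₁ (ZMod.castHom (Dvd.intro _ rfl) (ZMod M) n) _ fun i => ?_)
  have hsym := symmetric_of_midpoints ha hs _ hall
    (fun i i' l l' hi hl hci hcl => by
      have h1 := congrArg Prod.snd hci
      have h2 := congrArg Prod.snd hcl
      simp only [map_add, map_mul, map_intCast, zsmul_eq_mul] at h1 h2
      exact hc₂ (fun j => ZMod.castHom (hdvd j) (ZMod (q j)) n) _ hd i i' l l' hi hl h1 h2) i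
  have h1 := congrArg Prod.fst hsym
  simpa only [map_add, map_mul, map_intCast, zsmul_eq_mul] using h1

end Product

/-! ### Choice of parameters -/

section Parameters

/-- With `D = T²` the exact residues contribute `Y ^ T` and the `T` sums of squares `Y ^ (2 * T)`;
the product of the moduli has order about `Y ^ (T * T)`, a much larger power. -/
lemma card_midpointColor_le_mul_pow {D L T g Y : ℕ} (hT : 0 < T) (hg : 0 < g) (hY : 0 < Y)
    (hD : D = T * T) : Fintype.card (MidpointColor D L T (g * Y)) ≤
      ((2 * L) ^ D * (T * ((2 ^ D * g ^ T) * (D * g ^ 2 + 1) ^ T))) * Y ^ (3 * T) := by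
  refine (card_midpointColor_le D L T (g * Y) hT (by positivity)).trans ?_
  have h1 : D / T = T := by rw [hD]; exact Nat.mul_div_cancel T hT
  have h2 : D * (g * Y) ^ 2 + 1 ≤ (D * g ^ 2 + 1) * Y ^ 2 := by
    have : 1 ≤ Y ^ 2 := Nat.one_le_pow _ _ hY
    nlinarith
  rw [h1]
  calc _ ≤ (2 * L) ^ D * (T * ((2 ^ D * (g * Y) ^ T) * ((D * g ^ 2 + 1) * Y ^ 2) ^ T)) := by
        gcongr
    _ = _ := by rw [mul_pow _ (Y ^ 2), ← pow_mul, mul_pow g]; ring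

/-- For `M` large the number of colors provided by `HasFewColorings` is below any fixed root
of `M`. -/
lemma HasFewColorings.eventually {k : ℕ} {a : Fin k → ℤ} (h : HasFewColorings a) (m : ℕ) :
    ∃ M₀ : ℕ, ∀ M : ℕ, M₀ ≤ M → ∃ r : ℕ, r ^ m ≤ M ∧
      ∃ φ : Set.Icc (1 : ℤ) (M : ℤ) → Fin r, AvoidsSymmetric a φ := by
  obtain ⟨δ, hδ, h⟩ := h
  have hev : ∀ᶠ N in Filter.atTop, δ N < 1 / ((m : ℝ) + 1) :=
    hδ.eventually_lt_const (by positivity)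
  obtain ⟨M₀, hM₀⟩ := Filter.eventually_atTop.mp hev
  refine ⟨max M₀ 1, fun M hM => ?_⟩
  have hM1 : 1 ≤ M := (le_max_right _ _).trans hM
  obtain ⟨r, hr, φ, hφ⟩ := h M hM1
  refine ⟨r, ?_, φ, hφ⟩
  have hM1' : (1 : ℝ) ≤ M := by exact_mod_cast hM1
  have h1 := hM₀ M ((le_max_left _ _).trans hM)
  have h2 : (r : ℝ) ^ m ≤ M := by
    calc (r : ℝ) ^ m ≤ ((M : ℝ) ^ δ M) ^ m := by gcongr
      _ = (M : ℝ) ^ (δ M * m) := by rw [Real.rpow_mul (by positivity), Real.rpow_natCast]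
      _ ≤ (M : ℝ) ^ (1 : ℝ) := by
          refine Real.rpow_le_rpow_of_exponent_le hM1' ?_
          have h3 : δ M * m ≤ 1 / ((m : ℝ) + 1) * m := by gcongr
          refine h3.trans ?_
          rw [div_mul_eq_mul_div, div_le_one (by positivity)]
          linarith
      _ = M := Real.rpow_one _
  exact_mod_cast h2

/-- `Y` is the common scale of the moduli. For `α` about `Y ^ (-144 C k²)`, the bound on `Q` makes
`1/Q` of order at most `α ^ C`, while the exponent `108 = 72 + 36` (given coloring plus Behrend
coloring) stays below `144`. -/
lemma exists_coloring_of_scale {k : ℕ} (hk : 2 ≤ k) {a : Fin k → ℤ} (ha : StrictMono a)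
    (hs : IsSymmetric a) (hcol : HasFewColorings a) (C : ℕ) (hC : 0 < C) :
    ∃ c y₀ : ℕ, ∀ Y : ℕ, 0 < Y → y₀ ≤ Y → ∃ M Q : ℕ, Q ≤ M ∧ (Y ^ (144 * C * k ^ 2)) ^ C ≤ Q ∧
      ∃ (κ : Type) (_ : Fintype κ), Fintype.card κ ^ k ≤ c * Y ^ (108 * C * k ^ 2) ∧
        ∃ col : ZMod (M * Q) → κ, ∀ n d : ZMod (M * Q),
          ZMod.castHom (Dvd.intro _ rfl) (ZMod M) d ≠ 0 →
          ZMod.castHom (Dvd.intro_left M rfl) (ZMod Q) d ≠ 0 →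
          ∃ i, ∀ l, l ≠ i → col (n + a l • d) ≠ col (n + a i • d) := by
  have : NeZero k := ⟨by omega⟩
  have hlt : a 0 < a (Fin.rev 0) := ha (by
    rw [Fin.lt_def, Fin.val_rev]; simp; omega)
  obtain ⟨b, hb⟩ : ∃ b : ℕ, (b : ℤ) = a (Fin.rev 0) - a 0 :=
    ⟨(a (Fin.rev 0) - a 0).toNat, Int.toNat_of_nonneg (by omega)⟩
  have hb0 : 0 < b := by omega
  obtain ⟨B, hBdef⟩ : ∃ B : ℕ, B = ∏ p ∈ Finset.univ.offDiag (α := Fin k),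
      (a p.1 - a p.2).natAbs := ⟨_, rfl⟩
  have hB : 0 < B := hBdef ▸ Finset.prod_pos fun p hp => by
    rw [Finset.mem_offDiag] at hp
    exact Int.natAbs_pos.mpr (sub_ne_zero.mpr fun h => hp.2.2 (ha.injective h))
  have haB' : ∀ i j, i ≠ j → (a i - a j).natAbs ∣ B := fun i j hij => hBdef ▸
    Finset.dvd_prod_of_mem (fun p : Fin k × Fin k => (a p.1 - a p.2).natAbs)
      (a := (i, j)) (by simp [Finset.mem_offDiag, hij])
  have haB : ∀ i j, i ≠ j → (a i - a j) ∣ (B : ℤ) := fun i j hij =>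
    Int.dvd_natCast.mpr (haB' i j hij)
  have hbB : b ∣ B := by
    have := haB' (Fin.rev 0) 0 (fun h => by rw [h] at hlt; omega)
    rwa [← hb, Int.natAbs_natCast] at this
  obtain ⟨T, hTdef⟩ : ∃ x : ℕ, x = 12 * C * k := ⟨_, rfl⟩
  have hT : 0 < T := by rw [hTdef]; positivity
  obtain ⟨D, hD⟩ : ∃ x : ℕ, x = T * T := ⟨_, rfl⟩
  -- The factorial makes the moduli `(j + 1) * (G * Y) + 1` pairwise coprime, since differences of
  -- indices divide it; the factor `B` makes them coprime to `B`.
  obtain ⟨G, hG⟩ : ∃ x : ℕ, x = 4 * b * B * T * D.factorial := ⟨_, rfl⟩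
  have hGpos : 0 < G := by have := Nat.factorial_pos D; rw [hG]; positivity
  obtain ⟨g, hg⟩ : ∃ x : ℕ, x = (D + 1) * G := ⟨_, rfl⟩
  have hgpos : 0 < g := by rw [hg]; positivity
  obtain ⟨M₀, hM₀⟩ := hcol.eventually (4 * k * C)
  obtain ⟨c₂, hc₂⟩ : ∃ x : ℕ, x = (2 * (4 * b * B * T)) ^ D * (T * ((2 ^ D * g ^ T) * (D * g ^ 2 + 1) ^ T)) := ⟨_, rfl⟩
  obtain ⟨c₁, hc₁⟩ : ∃ x : ℕ, x = 9 * B * g ^ D := ⟨_, rfl⟩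
  refine ⟨(2 * (8 * b)) ^ k * c₁ * c₂ ^ k, M₀, fun Y hY hYM => ?_⟩
  obtain ⟨q, hq⟩ : ∃ q : Fin D → ℕ, ∀ j, q j = (j + 1) * (G * Y) + 1 := ⟨_, fun _ => rfl⟩
  have hGY : 0 < G * Y := Nat.mul_pos hGpos hY
  have hqlow : ∀ j, G * Y ≤ q j := fun j => by
    rw [hq]; nlinarith
  have hqmax : ∀ j, q j ≤ g * Y := fun j => by
    have h1 : (j : ℕ) + 1 ≤ D := j.2
    have h2 : ((j : ℕ) + 1) * (G * Y) ≤ D * (G * Y) := Nat.mul_le_mul_right _ h1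
    rw [hq, hg]
    linarith [show (D + 1) * G * Y = D * (G * Y) + G * Y by ring]
  have hBG : B ∣ G * Y := ⟨4 * b * T * D.factorial * Y, by rw [hG]; ring⟩
  have hcopsucc : ∀ {m n : ℕ}, m ∣ n → Nat.Coprime m (n + 1) := fun {m n} h =>
    Nat.Coprime.coprime_dvd_left h (by simp)
  have hcop : ∀ j, Nat.Coprime B (q j) := fun j => hq j ▸
    hcopsucc (hBG.trans (Dvd.intro_left _ rfl))
  have hpair : Pairwise fun i j => Nat.Coprime (q i) (q j) := by
    have key : ∀ i j : Fin D, i < j → Nat.Coprime (q i) (q j) := by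
      intro i j hij
      have hij' : (i : ℕ) < j := hij
      rw [hq, hq]
      refine Nat.coprime_mul_succ ?_
      have h1 : (j : ℕ) + 1 - (i + 1) ∣ D.factorial :=
        Nat.dvd_factorial (by omega) (by have := j.2; omega)
      refine h1.trans ⟨4 * b * B * T * Y, ?_⟩
      rw [hG]; ring
    intro i j hij
    rcases lt_or_gt_of_ne hij with h | h
    · exact key i j h
    · exact (key j i h).symm
  set Q : ℕ := ∏ j, q j with hQ
  have hQlow : Y ^ D ≤ Q := by
    calc Y ^ D = ∏ _j : Fin D, Y := by simp
      _ ≤ Q := Finset.prod_le_prod' fun j _ => le_trans (by nlinarith) (hqlow j)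
  have hQup : Q ≤ (g * Y) ^ D := by
    calc Q ≤ ∏ _j : Fin D, g * Y := Finset.prod_le_prod' fun j _ => hqmax j
      _ = _ := by simp
  have hQpos : 0 < Q := lt_of_lt_of_le (by positivity) hQlow
  -- Of the same order as `Q`, and congruent to `1` modulo `B`.
  obtain ⟨M, hM⟩ : ∃ x : ℕ, x = 8 * B * Q + 1 := ⟨_, rfl⟩
  have : NeZero M := ⟨by omega⟩
  have hQM : Q ≤ M := by
    calc Q = 1 * Q := (one_mul _).symm
      _ ≤ 8 * B * Q := Nat.mul_le_mul_right _ (by omega)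
      _ ≤ M := by omega
  have hbM : 8 * b ≤ M := by
    calc 8 * b = 8 * b * 1 := (mul_one _).symm
      _ ≤ 8 * B * Q := Nat.mul_le_mul (Nat.mul_le_mul_left 8 (Nat.le_of_dvd hB hbB)) hQpos
      _ ≤ M := by omega
  have hDpos : D ≠ 0 := by rw [hD]; positivity
  have hYQ : Y ≤ Q := (Nat.le_self_pow hDpos Y).trans hQlow
  have hcopM : Nat.Coprime B M := hM ▸ hcopsucc ⟨8 * Q, by ring⟩
  obtain ⟨r, hr, φ, hφ⟩ := hM₀ M (hYM.trans (hYQ.trans hQM))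
  obtain ⟨col, hcolp⟩ := exists_coloring_unique ha hs hb hb0 hB hT haB hbB hbM hcopM φ hφ q
    (fun j => le_trans (by
      have := Nat.factorial_pos D
      calc 4 * b * B * T = 4 * b * B * T * 1 * 1 := by ring
        _ ≤ 4 * b * B * T * D.factorial * Y := by gcongr <;> omega
        _ = G * Y := by rw [hG]) (hqlow j)) hqmax hcop hpair
  have hDC : D = 144 * C * k ^ 2 * C := by rw [hD, hTdef]; ring
  refine ⟨M, Q, hQM, by rw [← pow_mul, ← hDC]; exact hQlow, _, inferInstance, ?_, col, hcolp⟩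
  have hMup : M ≤ c₁ * Y ^ D := by
    have h1 : 1 ≤ B * Q := Nat.mul_pos hB hQpos
    calc M ≤ 9 * B * Q := by rw [hM]; linarith [mul_assoc 9 B Q, mul_assoc 8 B Q]
      _ ≤ 9 * B * (g * Y) ^ D := by gcongr
      _ = c₁ * Y ^ D := by rw [hc₁]; ring
  -- The `2C`-th root of `r ^ (4kC) ≤ M ≤ c₁ Y ^ D`, using `D = 144 C² k²`.
  have hrk : r ^ (2 * k) ≤ c₁ * Y ^ (72 * C * k ^ 2) := by
    rw [← Nat.pow_le_pow_iff_left (n := 2 * C) (by omega)]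
    have hc₁1 : 1 ≤ c₁ := by rw [hc₁]; exact Nat.succ_le_of_lt (by positivity)
    calc (r ^ (2 * k)) ^ (2 * C) = r ^ (4 * k * C) := by rw [← pow_mul]; congr 1; ring
      _ ≤ c₁ * Y ^ D := hr.trans hMup
      _ ≤ c₁ ^ (2 * C) * Y ^ D := by
          gcongr
          exact Nat.le_self_pow (by omega) c₁
      _ = (c₁ * Y ^ (72 * C * k ^ 2)) ^ (2 * C) := by
          rw [mul_pow, ← pow_mul, hDC]; congr 2; ring
  have hmid := card_midpointColor_le_mul_pow (L := 4 * b * B * T) hT hgpos hY hD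
  rw [← hc₂] at hmid
  rw [Fintype.card_prod, Fintype.card_prod, mul_pow]
  simp only [Fintype.card_pi, Fintype.card_fin, Finset.prod_const, Finset.card_univ]
  calc _ ≤ (2 * (8 * b) * r ^ 2) ^ k * (c₂ * Y ^ (3 * T)) ^ k := by gcongr
    _ = (2 * (8 * b)) ^ k * r ^ (2 * k) * (c₂ ^ k * Y ^ (36 * C * k ^ 2)) := by
        rw [mul_pow _ (r ^ 2), mul_pow c₂, ← pow_mul, ← pow_mul, hTdef]; congr 3; ring
    _ ≤ (2 * (8 * b)) ^ k * (c₁ * Y ^ (72 * C * k ^ 2)) * (c₂ ^ k * Y ^ (36 * C * k ^ 2)) := by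
        gcongr
    _ = _ := by ring

/-- The choice of parameters in terms of the density `α`. -/
lemma exists_coloring_of_density {k : ℕ} (hk : 2 ≤ k) {a : Fin k → ℤ} (ha : StrictMono a)
    (hs : IsSymmetric a) (hcol : HasFewColorings a) (C : ℕ) (hC : 0 < C) (K : ℕ) :
    ∃ α₀ : ℝ, 0 < α₀ ∧ α₀ < 1 ∧ ∀ α : ℝ, 0 < α → α < α₀ → ∃ M Q : ℕ, 0 < M ∧ 0 < Q ∧
      (M : ℝ)⁻¹ + (Q : ℝ)⁻¹ ≤ α ^ C / 2 ∧
      ∃ (κ : Type) (_ : Fintype κ), (Fintype.card κ : ℝ) ^ k * K * α < 1 ∧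
        ∃ col : ZMod (M * Q) → κ, ∀ n d : ZMod (M * Q),
          ZMod.castHom (Dvd.intro _ rfl) (ZMod M) d ≠ 0 →
          ZMod.castHom (Dvd.intro_left M rfl) (ZMod Q) d ≠ 0 →
          ∃ i, ∀ l, l ≠ i → col (n + a l • d) ≠ col (n + a i • d) := by
  obtain ⟨c, y₀, hscale⟩ := exists_coloring_of_scale hk ha hs hcol C hC
  set D' : ℕ := 144 * C * k ^ 2 with hD'
  have hD'pos : D' ≠ 0 := by have : 0 < k := by omega
                             positivity
  set z : ℕ := max y₀ (c * K * (4 * 2 ^ D')) + 1 with hz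
  refine ⟨1 / ((z : ℝ) ^ D' + 1), by positivity, ?_, fun α hα hα' => ?_⟩
  · rw [div_lt_one (by positivity)]
    have : 0 < (z : ℝ) ^ D' := by rw [hz]; positivity
    linarith
  have hα1 : α * ((z : ℝ) ^ D' + 1) < 1 := by rwa [lt_div_iff₀ (by positivity)] at hα'
  have hex : ∃ Y : ℕ, 4 ≤ α * (Y : ℝ) ^ D' := by
    obtain ⟨Y, hY⟩ := exists_nat_ge (4 / α)
    refine ⟨Y + 1, ?_⟩
    rw [div_le_iff₀ hα] at hY
    have h1 : ((Y + 1 : ℕ) : ℝ) ≤ ((Y + 1 : ℕ) : ℝ) ^ D' := le_self_pow₀ (by simp) hD'pos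
    push_cast at h1 ⊢
    nlinarith
  classical
  -- Minimality of `Y` pins `α * Y ^ D'` between `4` and `4 * 2 ^ D'`; the threshold `z` makes `Y`
  -- exceed all remaining constants.
  obtain ⟨Y, hY4, hYmin⟩ : ∃ Y : ℕ, 4 ≤ α * (Y : ℝ) ^ D' ∧
      ∀ Y' : ℕ, Y' < Y → α * (Y' : ℝ) ^ D' < 4 :=
    ⟨Nat.find hex, Nat.find_spec hex, fun Y' h => not_le.mp (Nat.find_min hex h)⟩
  have hzY : z < Y := by
    by_contra! hle
    have h1 : (Y : ℝ) ^ D' ≤ (z : ℝ) ^ D' := by gcongr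
    nlinarith
  have hY2 : 2 ≤ Y := by omega
  have hYup : α * (Y : ℝ) ^ D' ≤ 4 * 2 ^ D' := by
    have h1 := hYmin (Y - 1) (by omega)
    have h2 : (Y : ℝ) ≤ 2 * ((Y - 1 : ℕ) : ℝ) := by
      rw [Nat.cast_sub (by omega)]
      have : (2 : ℝ) ≤ Y := by exact_mod_cast hY2
      push_cast; linarith
    calc α * (Y : ℝ) ^ D' ≤ α * (2 * ((Y - 1 : ℕ) : ℝ)) ^ D' := by gcongr
      _ = (α * ((Y - 1 : ℕ) : ℝ) ^ D') * 2 ^ D' := by rw [mul_pow]; ring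
      _ ≤ _ := by gcongr
  obtain ⟨M, Q, hQM, hQ, κ, hκ, hcard, col, hcolp⟩ := hscale Y (by omega)
    (by have := le_max_left y₀ (c * K * (4 * 2 ^ D')); omega)
  have hQpos : 0 < Q := lt_of_lt_of_le (by positivity) hQ
  have hα_lt : α < 1 := by nlinarith [show (0 : ℝ) ≤ (z : ℝ) ^ D' by positivity]
  refine ⟨M, Q, hQpos.trans_le hQM, hQpos, ?_, κ, hκ, ?_, col, hcolp⟩
  · have hQ' : ((Y : ℝ) ^ D') ^ C ≤ Q := by exact_mod_cast hQ
    have hQr : (0 : ℝ) < Q := by exact_mod_cast hQpos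
    have h1 : (M : ℝ)⁻¹ ≤ (Q : ℝ)⁻¹ := by
      gcongr
    have h2 : 4 ≤ α ^ C * Q := by
      calc (4 : ℝ) ≤ 4 ^ C := le_self_pow₀ (by norm_num) hC.ne'
        _ ≤ (α * (Y : ℝ) ^ D') ^ C := by gcongr
        _ = α ^ C * ((Y : ℝ) ^ D') ^ C := mul_pow _ _ _
        _ ≤ _ := by gcongr
    have h3 : (Q : ℝ)⁻¹ ≤ α ^ C / 4 := by
      rw [inv_eq_one_div, div_le_iff₀ hQr]
      linarith
    linarith
  · have hcard' : (Fintype.card κ : ℝ) ^ k ≤ c * (Y : ℝ) ^ (108 * C * k ^ 2) := by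
      exact_mod_cast hcard
    have hYr : (1 : ℝ) ≤ Y := by exact_mod_cast (by omega : 1 ≤ Y)
    -- The gap between the exponents `108` and `144` leaves room for one spare factor `Y`, which
    -- absorbs the constants.
    have hpow : (Y : ℝ) * (Y : ℝ) ^ (108 * C * k ^ 2) ≤ (Y : ℝ) ^ D' := by
      rw [← pow_succ']
      refine pow_le_pow_right₀ hYr ?_
      have : 0 < C * k ^ 2 := by have : 0 < k := by omega
                                 positivity
      rw [hD']
      nlinarith
    have hYc : (c : ℝ) * K * (4 * 2 ^ D') < Y := by
      have h1 : c * K * (4 * 2 ^ D') < Y := by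
        have := le_max_right y₀ (c * K * (4 * 2 ^ D')); omega
      exact_mod_cast h1
    have h1 : (Y : ℝ) * ((Fintype.card κ : ℝ) ^ k * K * α) < Y * 1 := by
      calc (Y : ℝ) * ((Fintype.card κ : ℝ) ^ k * K * α)
          ≤ (Y : ℝ) * ((c * (Y : ℝ) ^ (108 * C * k ^ 2)) * K * α) := by gcongr
        _ = c * K * (α * (Y * (Y : ℝ) ^ (108 * C * k ^ 2))) := by ring
        _ ≤ c * K * (α * (Y : ℝ) ^ D') := by gcongr
        _ ≤ c * K * (4 * 2 ^ D') := by gcongr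
        _ < Y * 1 := by linarith
    exact lt_of_mul_lt_mul_left h1 (by positivity)

end Parameters

/-! ### Averages over finite groups -/

section Expectation

lemma norm_expect_le {ι : Type*} [Fintype ι] (f : ι → ℂ) : ‖𝔼 i, f i‖ ≤ 𝔼 i, ‖f i‖ := by
  rw [Fintype.expect_eq_sum_div_card, Fintype.expect_eq_sum_div_card, norm_div]
  simp only [Complex.norm_natCast]
  gcongr
  exact norm_sum_le _ _

lemma norm_expect_le_of_forall {ι : Type*} [Fintype ι] {f : ι → ℂ} {B : ℝ} (hB : 0 ≤ B)
    (hf : ∀ i, ‖f i‖ ≤ B) : ‖𝔼 i, f i‖ ≤ B := by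
  rcases isEmpty_or_nonempty ι with h | h
  · simpa [Finset.univ_eq_empty] using hB
  · calc _ ≤ 𝔼 i, ‖f i‖ := norm_expect_le f
      _ ≤ 𝔼 _i : ι, B := Finset.expect_le_expect fun i _ => hf i
      _ = B := Fintype.expect_const B

lemma expect_sq_le {ι : Type*} [Fintype ι] (f : ι → ℝ) : (𝔼 i, f i) ^ 2 ≤ 𝔼 i, f i ^ 2 := by
  rw [Fintype.expect_eq_sum_div_card, Fintype.expect_eq_sum_div_card, div_pow]
  rcases isEmpty_or_nonempty ι with h | h
  · simp
  have hc : (0 : ℝ) < Fintype.card ι := by exact_mod_cast Fintype.card_pos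
  rw [div_le_div_iff₀ (by positivity) hc]
  have h1 := sq_sum_le_card_mul_sum_sq (s := Finset.univ) (f := f)
  rw [Finset.card_univ] at h1
  nlinarith

lemma expect_fin_succ {G M : Type*} [Fintype G] [AddCommMonoid M] [Module ℚ≥0 M] {s : ℕ}
    (F : (Fin (s + 1) → G) → M) :
    𝔼 h, F h = 𝔼 h₁ : G, 𝔼 h' : Fin s → G, F (Fin.cons h₁ h') := by
  rw [← Finset.expect_product' (s := Finset.univ) (t := Finset.univ)
    (f := fun (h₁ : G) (h' : Fin s → G) => F (Fin.cons h₁ h')), Finset.univ_product_univ]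
  exact (Fintype.expect_equiv (Fin.consEquiv fun _ => G) _ _ fun _ => rfl).symm

lemma expect_sub_right {G M : Type*} [AddCommGroup G] [Fintype G] [AddCommMonoid M] [Module ℚ≥0 M]
    (f : G → M) (x : G) : 𝔼 h, f (x - h) = 𝔼 h, f h :=
  Fintype.expect_equiv (Equiv.subLeft x) _ _ fun _ => rfl

lemma expect_add_shift {G M : Type*} [AddCommGroup G] [Fintype G] [AddCommMonoid M] [Module ℚ≥0 M]
    (f : G → M) (x : G) : 𝔼 h, f (h + x) = 𝔼 h, f h :=
  Fintype.expect_equiv (Equiv.addRight x) _ _ fun _ => rfl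

/-- `|𝔼 u|² = 𝔼_k 𝔼_x u(x) conj (u(x - k))`. -/
lemma norm_expect_sq {G : Type*} [AddCommGroup G] [Fintype G] (u : G → ℂ) :
    ((‖𝔼 x, u x‖ ^ 2 : ℝ) : ℂ) = 𝔼 k, 𝔼 x, u x * (starRingEnd ℂ) (u (x - k)) := by
  rw [Finset.expect_comm]
  have h1 : ∀ x, 𝔼 k, u x * (starRingEnd ℂ) (u (x - k)) =
      u x * (starRingEnd ℂ) (𝔼 y, u y) := by
    intro x
    rw [← Finset.mul_expect, expect_sub_right (fun y => (starRingEnd ℂ) (u y))]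
    congr 1
    rw [Fintype.expect_eq_sum_div_card, Fintype.expect_eq_sum_div_card, map_div₀, map_sum,
      map_natCast]
  simp only [h1]
  rw [← Finset.expect_mul, Complex.mul_conj']
  push_cast
  rfl

end Expectation

/-! ### Cube averages and the Cauchy–Schwarz step -/

section CubeWeight

variable {G : Type*} [AddCommGroup G]

/-- Products over the vertices of an `s`-dimensional cube other than the base point of bounded
functions, where the functions may depend on the directions that do not move the vertex. -/
def IsCubeWeight : ∀ s : ℕ, (G → (Fin s → G) → ℂ) → Prop
  | 0, Ψ => ∃ c : ℂ, ‖c‖ ≤ 1 ∧ ∀ x h, Ψ x h = c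
  | s + 1, Ψ => ∃ Ψ₀ : G → (Fin s → G) → ℂ, IsCubeWeight s Ψ₀ ∧ ∃ Θ : G → (Fin s → G) → ℂ,
      (∀ x h, ‖Θ x h‖ ≤ 1) ∧ ∀ x h, Ψ x h = Ψ₀ x (Fin.tail h) * Θ (x - h 0) (Fin.tail h)

lemma IsCubeWeight.norm_le {s : ℕ} {Ψ : G → (Fin s → G) → ℂ} (h : IsCubeWeight s Ψ) :
    ∀ x h, ‖Ψ x h‖ ≤ 1 := by
  induction s with
  | zero =>
    obtain ⟨c, hc, h⟩ := h
    exact fun x y => by rw [h]; exact hc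
  | succ s ih =>
    obtain ⟨Ψ₀, h₀, Θ, hΘ, h⟩ := h
    intro x y
    rw [h, norm_mul]
    exact mul_le_one₀ (ih h₀ _ _) (norm_nonneg _) (hΘ _ _)

/-- This closure property is what allows the Cauchy–Schwarz step to be iterated: differencing the
base point differences each vertex function separately. -/
lemma IsCubeWeight.mulDeriv {s : ℕ} {Ψ : G → (Fin s → G) → ℂ} (h : IsCubeWeight s Ψ) (k : G) :
    IsCubeWeight s fun x h => Ψ x h * (starRingEnd ℂ) (Ψ (x - k) h) := by
  induction s with
  | zero =>
    obtain ⟨c, hc, h⟩ := h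
    refine ⟨c * (starRingEnd ℂ) c, ?_, fun x y => by simp only [h]⟩
    rw [norm_mul, RCLike.norm_conj]
    exact mul_le_one₀ hc (norm_nonneg _) hc
  | succ s ih =>
    obtain ⟨Ψ₀, h₀, Θ, hΘ, h⟩ := h
    refine ⟨_, ih h₀, fun x h => Θ x h * (starRingEnd ℂ) (Θ (x - k) h), fun x h => ?_,
      fun x y => ?_⟩
    · rw [norm_mul, RCLike.norm_conj]
      exact mul_le_one₀ (hΘ _ _) (norm_nonneg _) (hΘ _ _)
    · simp only [h, map_mul]
      rw [sub_right_comm x k]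
      ring

lemma norm_iterMulDeriv_le {f : G → ℂ} (hf : ∀ x, ‖f x‖ ≤ 1) {s : ℕ} (h : Fin s → G) (x : G) :
    ‖iterMulDeriv h f x‖ ≤ 1 := by
  unfold iterMulDeriv
  induction List.ofFn h generalizing x with
  | nil => exact hf x
  | cons a l ih =>
    rw [List.foldr_cons, APDensity.mulDeriv, norm_mul, RCLike.norm_conj]
    exact mul_le_one₀ (ih _) (norm_nonneg _) (ih _)

/-- Only the factor at the base point keeps the structure of `f`; the factors at the other vertices
are used only through their boundedness. -/
lemma exists_cubeWeight {f : G → ℂ} (hf : ∀ x, ‖f x‖ ≤ 1) (s : ℕ) :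
    ∃ Ψ : G → (Fin s → G) → ℂ, IsCubeWeight s Ψ ∧ ∀ h x, iterMulDeriv h f x = f x * Ψ x h := by
  induction s with
  | zero => exact ⟨fun _ _ => 1, ⟨1, by simp, fun _ _ => rfl⟩, fun h x => by simp [iterMulDeriv]⟩
  | succ s ih =>
    obtain ⟨Ψ₀, h₀, hΨ⟩ := ih
    refine ⟨_, ⟨Ψ₀, h₀, fun x h => (starRingEnd ℂ) (iterMulDeriv h f x), fun x h => ?_,
      fun x h => rfl⟩, fun h x => ?_⟩
    · rw [RCLike.norm_conj]
      exact norm_iterMulDeriv_le hf h x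
    · conv_lhs => rw [← Fin.cons_self_tail h, iterMulDeriv, List.ofFn_cons, List.foldr_cons]
      change iterMulDeriv (Fin.tail h) f x *
        (starRingEnd ℂ) (iterMulDeriv (Fin.tail h) f (x - h 0)) = _
      rw [hΨ, mul_assoc]

variable [Fintype G]

/-- For fixed `x` the point `x - h 0` is equidistributed, so `Θ` averages to a factor of modulus at
most one. -/
lemma norm_cubeAverage_le {s : ℕ} (g : G → ℂ) {Ψ : G → (Fin (s + 1) → G) → ℂ}
    {Ψ₀ Θ : G → (Fin s → G) → ℂ} (hΘ : ∀ x h, ‖Θ x h‖ ≤ 1)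
    (hΨ : ∀ x h, Ψ x h = Ψ₀ x (Fin.tail h) * Θ (x - h 0) (Fin.tail h)) :
    ‖𝔼 x, 𝔼 h, g x * Ψ x h‖ ≤ 𝔼 h : Fin s → G, ‖𝔼 x, g x * Ψ₀ x h‖ := by
  have h1 : 𝔼 x, 𝔼 h, g x * Ψ x h =
      𝔼 h : Fin s → G, (𝔼 x, g x * Ψ₀ x h) * 𝔼 y, Θ y h := by
    calc 𝔼 x, 𝔼 h, g x * Ψ x h
        = 𝔼 x, 𝔼 h : Fin s → G, (g x * Ψ₀ x h) * 𝔼 y, Θ y h := by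
          refine Finset.expect_congr rfl fun x _ => ?_
          rw [expect_fin_succ, Finset.expect_comm]
          refine Finset.expect_congr rfl fun h _ => ?_
          rw [← expect_sub_right (fun y => Θ y h) x, Finset.mul_expect]
          refine Finset.expect_congr rfl fun h₁ _ => ?_
          rw [hΨ, Fin.tail_cons, Fin.cons_zero]
          ring
      _ = _ := by
          rw [Finset.expect_comm]
          refine Finset.expect_congr rfl fun h _ => ?_
          rw [Finset.expect_mul]
  rw [h1]
  refine (norm_expect_le _).trans (Finset.expect_le_expect fun h _ => ?_)
  rw [norm_mul]
  exact mul_le_of_le_one_right (norm_nonneg _) (norm_expect_le_of_forall zero_le_one fun y => hΘ y h)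

/-- The Cauchy–Schwarz step for Gowers norms. -/
lemma norm_cubeAverage_sq_le {s : ℕ} (g : G → ℂ) {Ψ : G → (Fin (s + 1) → G) → ℂ}
    {Ψ₀ Θ : G → (Fin s → G) → ℂ} (hΘ : ∀ x h, ‖Θ x h‖ ≤ 1)
    (hΨ : ∀ x h, Ψ x h = Ψ₀ x (Fin.tail h) * Θ (x - h 0) (Fin.tail h)) :
    ‖𝔼 x, 𝔼 h, g x * Ψ x h‖ ^ 2 ≤
      𝔼 k, ‖𝔼 x, 𝔼 h, mulDeriv k g x * (Ψ₀ x h * (starRingEnd ℂ) (Ψ₀ (x - k) h))‖ := by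
  have h1 : ‖𝔼 x, 𝔼 h, g x * Ψ x h‖ ^ 2 ≤ 𝔼 h : Fin s → G, ‖𝔼 x, g x * Ψ₀ x h‖ ^ 2 :=
    (pow_le_pow_left₀ (norm_nonneg _) (norm_cubeAverage_le g hΘ hΨ) 2).trans (expect_sq_le _)
  have h2 : ((𝔼 h : Fin s → G, ‖𝔼 x, g x * Ψ₀ x h‖ ^ 2 : ℝ) : ℂ) =
      𝔼 k, 𝔼 x, 𝔼 h, mulDeriv k g x * (Ψ₀ x h * (starRingEnd ℂ) (Ψ₀ (x - k) h)) := by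
    rw [Complex.ofReal_expect]
    simp only [norm_expect_sq]
    rw [Finset.expect_comm]
    refine Finset.expect_congr rfl fun k _ => ?_
    rw [Finset.expect_comm]
    refine Finset.expect_congr rfl fun x _ => Finset.expect_congr rfl fun h _ => ?_
    rw [mulDeriv, map_mul]
    ring
  have h3 : 0 ≤ 𝔼 h : Fin s → G, ‖𝔼 x, g x * Ψ₀ x h‖ ^ 2 :=
    Finset.expect_nonneg fun h _ => by positivity
  calc _ ≤ 𝔼 h : Fin s → G, ‖𝔼 x, g x * Ψ₀ x h‖ ^ 2 := h1
    _ = ‖((𝔼 h : Fin s → G, ‖𝔼 x, g x * Ψ₀ x h‖ ^ 2 : ℝ) : ℂ)‖ := by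
        rw [Complex.norm_real, Real.norm_of_nonneg h3]
    _ ≤ _ := by rw [h2]; exact norm_expect_le _

end CubeWeight

/-! ### Polynomial phases modulo a prime -/

section Phase

variable {p : ℕ}

/-- Functions on `ℤ/pℤ` whose `s`-fold nontrivial differences are affine and nonconstant. -/
def IsPhase : ℕ → (ZMod p → ZMod p) → Prop
  | 0, R => ∃ c e : ZMod p, c ≠ 0 ∧ ∀ x, R x = c * x + e
  | s + 1, R => ∀ k, k ≠ 0 → IsPhase s fun x => R x - R (x - k)

-- Differencing lowers the degree by exactly one: the new leading coefficient is the old one times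
-- the degree times `k`, and the degree is nonzero modulo `p`.
open Polynomial in
lemma isPhase_eval [Fact p.Prime] (s : ℕ) (P : (ZMod p)[X]) (hP : P.natDegree = s + 1)
    (hs : s + 1 < p) : IsPhase s fun x => P.eval x := by
  induction s generalizing P with
  | zero =>
    obtain ⟨u, v, rfl⟩ := exists_eq_X_add_C_of_natDegree_le_one hP.le
    refine ⟨u, v, ?_, fun x => by simp⟩
    rintro rfl
    simp at hP
  | succ s ih =>
    intro k hk
    have hcoeff : ∀ n, P.natDegree ≤ n → (P - taylor (-k) P).coeff n = 0 := by
      intro n hn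
      rw [coeff_sub]
      rcases hn.eq_or_lt with rfl | hn
      · rw [coeff_taylor_natDegree, coeff_natDegree, sub_self]
      · rw [coeff_eq_zero_of_natDegree_lt hn, coeff_eq_zero_of_natDegree_lt
          (by rwa [natDegree_taylor]), sub_self]
    have htop : (P - taylor (-k) P).coeff (s + 1) ≠ 0 := by
      have hdeg : (hasseDeriv (s + 1) P).natDegree < 2 := by
        have := natDegree_hasseDeriv_le P (s + 1)
        omega
      rw [coeff_sub, taylor_coeff, eval_eq_sum_range' hdeg, Finset.sum_range_succ,
        Finset.sum_range_one, hasseDeriv_coeff, hasseDeriv_coeff]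
      have hlead : P.coeff (s + 1 + 1) ≠ 0 := by
        rw [← hP, coeff_natDegree, leadingCoeff_ne_zero]
        rintro rfl
        simp at hP
      have hcast : ((s + 2 : ℕ) : ZMod p) ≠ 0 := by
        rw [Ne, ZMod.natCast_eq_zero_iff]
        exact fun h => absurd (Nat.le_of_dvd (by omega) h) (by omega)
      have hchoose : (1 + (s + 1)).choose (s + 1) = s + 2 := by
        rw [add_comm 1, Nat.choose_succ_self_right]
      rw [hchoose, add_comm 1 (s + 1)]
      simp only [zero_add, Nat.choose_self, Nat.cast_one, one_mul, pow_zero, mul_one, pow_one]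
      have : P.coeff (s + 1) - (P.coeff (s + 1) + ((s + 2 : ℕ) : ZMod p) * P.coeff (s + 1 + 1) * -k)
          = ((s + 2 : ℕ) : ZMod p) * P.coeff (s + 1 + 1) * k := by ring
      rw [this]
      exact mul_ne_zero (mul_ne_zero hcast hlead) hk
    have hdeg : (P - taylor (-k) P).natDegree = s + 1 := by
      refine le_antisymm ?_ (le_natDegree_of_ne_zero htop)
      rw [natDegree_le_iff_coeff_eq_zero]
      exact fun n hn => hcoeff n (by omega)
    have := ih _ hdeg (by omega)
    simpa [taylor_eval, sub_eq_add_neg, add_comm] using this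

lemma isPhase_const_mul_pow [Fact p.Prime] (s : ℕ) (hs : s + 1 < p) {ξ : ZMod p} (hξ : ξ ≠ 0) :
    IsPhase s fun x => ξ * x ^ (s + 1) := by
  have := isPhase_eval s (Polynomial.C ξ * Polynomial.X ^ (s + 1))
    (Polynomial.natDegree_C_mul_X_pow _ _ hξ) hs
  simpa using this

end Phase

/-! ### Fibers of surjective homomorphisms -/

section Kernel

lemma card_eq_card_mul_card_fiber {G H : Type*} [AddCommGroup G] [Fintype G] [AddCommGroup H]
    [Fintype H] [DecidableEq H] (π : G →+ H) (hπ : Function.Surjective π) (z : H) :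
    Fintype.card G = Fintype.card H * (Finset.univ.filter fun x => π x = z).card := by
  have hfib : ∀ y : H, (Finset.univ.filter fun x => π x = y).card =
      (Finset.univ.filter fun x => π x = z).card := fun y =>
    AddMonoidHom.card_fiber_eq_of_mem_range π (hπ y) (hπ z)
  have h1 := Finset.card_eq_sum_card_fiberwise (f := π) (s := Finset.univ) (t := Finset.univ)
    fun x _ => Finset.mem_coe.mpr (Finset.mem_univ _)
  rw [Finset.card_univ] at h1
  rw [h1]
  simp only [hfib, Finset.sum_const, Finset.card_univ, smul_eq_mul]

lemma expect_ite_map_eq_zero {G H : Type*} [AddCommGroup G] [Fintype G] [AddCommGroup H]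
    [Fintype H] [DecidableEq H] (π : G →+ H) (hπ : Function.Surjective π) :
    𝔼 x, (if π x = 0 then (1 : ℝ) else 0) = (Fintype.card H : ℝ)⁻¹ := by
  rw [Fintype.expect_eq_sum_div_card, Finset.sum_boole, card_eq_card_mul_card_fiber π hπ 0]
  have h0 : 0 < (Finset.univ.filter fun x => π x = 0).card :=
    Finset.card_pos.mpr ⟨0, by simp⟩
  have h1 : ((Finset.univ.filter fun x => π x = 0).card : ℝ) ≠ 0 := by exact_mod_cast h0.ne'
  push_cast
  rw [div_mul_cancel_right₀ h1]

lemma surjective_of_map_ne_zero {G : Type*} [AddCommGroup G] {p : ℕ} [Fact p.Prime]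
    (π : G →+ ZMod p) {t : G} (ht : π t ≠ 0) : Function.Surjective π := by
  intro y
  refine ⟨(y / π t).val • t, ?_⟩
  rw [map_nsmul, nsmul_eq_mul, ZMod.natCast_zmod_val, div_mul_cancel₀ _ ht]

end Kernel

/-! ### Cancellation in cube averages of phases -/

section PhaseAverage

variable {G : Type*} [AddCommGroup G] [Fintype G] {p : ℕ} [Fact p.Prime]

/-- The bound for cube averages of polynomial phases of degree `s + 1` modulo `p`. -/
noncomputable def phaseBound (p : ℕ) : ℕ → ℝ
  | 0 => 0
  | s + 1 => Real.sqrt (phaseBound p s + (p : ℝ)⁻¹)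

lemma phaseBound_nonneg (p : ℕ) : ∀ s, 0 ≤ phaseBound p s
  | 0 => le_rfl
  | _ + 1 => Real.sqrt_nonneg _

lemma tendsto_phaseBound (s : ℕ) :
    Filter.Tendsto (fun p => phaseBound p s) Filter.atTop (nhds 0) := by
  induction s with
  | zero => exact tendsto_const_nhds
  | succ s ih =>
    have h := (ih.add (tendsto_inv_atTop_nhds_zero_nat (𝕜 := ℝ))).sqrt
    simpa [phaseBound] using h

/-- Cauchy–Schwarz replaces `R` by its difference in direction `π k`, a phase one step lower unless
`π k = 0`, which has probability `1/p`; this gives the recursion in `phaseBound`. Invariance of `β`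
under `t` survives differencing. For affine `R`, translating by `t` multiplies the average by a
nontrivial root of unity, so it vanishes. -/
lemma norm_phaseAverage_le (π : G →+ ZMod p) {t : G} (ht : π t ≠ 0) (s : ℕ)
    {R : ZMod p → ZMod p} (hR : IsPhase s R) {β : G → ℂ} (hβ : ∀ x, ‖β x‖ ≤ 1)
    (hβt : ∀ x, β (x + t) = β x) {Ψ : G → (Fin (s + 1) → G) → ℂ} (hΨ : IsCubeWeight (s + 1) Ψ) :
    ‖𝔼 x, 𝔼 h, β x * ZMod.stdAddChar (R (π x)) * Ψ x h‖ ≤ phaseBound p s := by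
  induction s generalizing R β with
  | zero =>
    obtain ⟨Ψ₀, ⟨c, hc, hΨ₀⟩, Θ, hΘ, hΨ⟩ := hΨ
    obtain ⟨u, v, hu, hR⟩ := hR
    refine (norm_cubeAverage_le _ hΘ hΨ).trans (le_of_eq ?_)
    refine Finset.expect_eq_zero fun h _ => ?_
    simp only [hΨ₀, norm_eq_zero]
    rw [← Finset.expect_mul]
    set E := 𝔼 x, β x * ZMod.stdAddChar (R (π x)) with hE
    have h1 : E = ZMod.stdAddChar (u * π t) * E := by
      conv_lhs => rw [hE, ← expect_add_shift _ t]
      rw [hE, Finset.mul_expect]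
      refine Finset.expect_congr rfl fun x _ => ?_
      rw [hβt, hR, hR, π.map_add, show u * (π x + π t) + v = u * π t + (u * π x + v) by ring,
        AddChar.map_add_eq_mul]
      ring
    have h2 : ZMod.stdAddChar (u * π t) ≠ (1 : ℂ) := by
      intro h
      exact mul_ne_zero hu ht (ZMod.injective_stdAddChar (h.trans (AddChar.map_zero_eq_one _).symm))
    have h3 : E = 0 := by
      have : (ZMod.stdAddChar (u * π t) - 1) * E = 0 := by linear_combination -h1
      exact (mul_eq_zero.mp this).resolve_left (sub_ne_zero.mpr h2)
    rw [h3, zero_mul]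
  | succ s ih =>
    obtain ⟨Ψ₀, hΨ₀, Θ, hΘ, hΨ⟩ := hΨ
    refine Real.le_sqrt_of_sq_le ((norm_cubeAverage_sq_le _ hΘ hΨ).trans ?_)
    have hstep : ∀ k, ‖𝔼 x, 𝔼 h, mulDeriv k (fun x => β x * ZMod.stdAddChar (R (π x))) x *
        (Ψ₀ x h * (starRingEnd ℂ) (Ψ₀ (x - k) h))‖ ≤
        phaseBound p s + if π k = 0 then (1 : ℝ) else 0 := by
      intro k
      split_ifs with hk
      · refine (norm_expect_le_of_forall zero_le_one fun x =>
          norm_expect_le_of_forall zero_le_one fun h => ?_).trans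
          (le_add_of_nonneg_left (phaseBound_nonneg p s))
        have hn := (hΨ₀.mulDeriv k).norm_le x h
        rw [norm_mul]
        refine mul_le_one₀ ?_ (norm_nonneg _) hn
        rw [mulDeriv, norm_mul, RCLike.norm_conj, norm_mul, norm_mul, AddChar.norm_apply,
          AddChar.norm_apply, mul_one, mul_one]
        exact mul_le_one₀ (hβ _) (norm_nonneg _) (hβ _)
      · rw [add_zero]
        have := ih (hR (π k) hk) (β := fun x => β x * (starRingEnd ℂ) (β (x - k)))
          (fun x => by
            rw [norm_mul, RCLike.norm_conj]
            exact mul_le_one₀ (hβ _) (norm_nonneg _) (hβ _))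
          (fun x => by rw [hβt, add_sub_right_comm, hβt]) (hΨ₀.mulDeriv k)
        convert this using 8 with x h
        rw [mulDeriv, map_mul, map_sub, sub_eq_add_neg (R (π x)), AddChar.map_add_eq_mul,
          AddChar.map_neg_eq_conj]
        ring
    calc _ ≤ 𝔼 k, (phaseBound p s + if π k = 0 then (1 : ℝ) else 0) :=
          Finset.expect_le_expect fun k _ => hstep k
      _ = phaseBound p s + (p : ℝ)⁻¹ := by
          rw [Finset.expect_add_distrib, Fintype.expect_const,
            expect_ite_map_eq_zero π (surjective_of_map_ne_zero π ht), ZMod.card]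

end PhaseAverage

/-! ### Fourier analysis on `ℤ/pℤ` -/

section Fourier

variable {p : ℕ} [NeZero p]

/-- The (unnormalized) Fourier coefficients of a function on `ℤ/pℤ`. -/
noncomputable def fourierCoeff (u : ZMod p → ℂ) (ξ : ZMod p) : ℂ :=
  ∑ v, u v * ZMod.stdAddChar (-(ξ * v))

lemma sum_fourierCoeff_mul (u : ZMod p → ℂ) (y : ZMod p) :
    ∑ ξ, fourierCoeff u ξ * ZMod.stdAddChar (ξ * y) = p * u y := by
  simp only [fourierCoeff, Finset.sum_mul]
  rw [Finset.sum_comm]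
  have h1 : ∀ v, ∑ ξ, u v * ZMod.stdAddChar (-(ξ * v)) * ZMod.stdAddChar (ξ * y) =
      u v * if y - v = 0 then (p : ℂ) else 0 := by
    intro v
    have h2 := AddChar.sum_mulShift (y - v) (ZMod.isPrimitive_stdAddChar p)
    rw [ZMod.card] at h2
    rw [show (if y - v = 0 then (p : ℂ) else 0) = ((if y - v = 0 then p else 0 : ℕ) : ℂ) by
      push_cast; rfl, ← h2, Finset.mul_sum]
    refine Finset.sum_congr rfl fun ξ _ => ?_
    rw [mul_assoc, ← AddChar.map_add_eq_mul]
    congr 2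
    ring
  simp only [h1, sub_eq_zero, mul_ite, mul_zero, Finset.sum_ite_eq, Finset.mem_univ, if_true]
  ring

lemma sum_norm_fourierCoeff_sq (u : ZMod p → ℂ) :
    ∑ ξ, ‖fourierCoeff u ξ‖ ^ 2 = p * ∑ v, ‖u v‖ ^ 2 := by
  have h1 : (∑ ξ, ‖fourierCoeff u ξ‖ ^ 2 : ℂ) = p * ∑ v, (‖u v‖ : ℂ) ^ 2 := by
    calc (∑ ξ, ‖fourierCoeff u ξ‖ ^ 2 : ℂ)
        = ∑ ξ, ∑ v, (starRingEnd ℂ) (u v) *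
            (fourierCoeff u ξ * ZMod.stdAddChar (ξ * v)) := by
          refine Finset.sum_congr rfl fun ξ _ => ?_
          rw [← Complex.mul_conj']
          conv_lhs => rw [fourierCoeff.eq_def u ξ, map_sum, ← fourierCoeff.eq_def u ξ,
            Finset.mul_sum]
          refine Finset.sum_congr rfl fun v _ => ?_
          rw [map_mul, ← AddChar.map_neg_eq_conj, neg_neg]
          ring
      _ = ∑ v, (starRingEnd ℂ) (u v) * (p * u v) := by
          rw [Finset.sum_comm]
          refine Finset.sum_congr rfl fun v _ => ?_
          rw [← Finset.mul_sum, sum_fourierCoeff_mul]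
      _ = _ := by
          rw [Finset.mul_sum]
          refine Finset.sum_congr rfl fun v _ => ?_
          rw [← Complex.mul_conj']
          ring
  exact_mod_cast h1

/-- Averaging a bounded function over translates bounds the `ℓ¹`-norm of its Fourier
coefficients. -/
lemma exists_fourier_average (u : ZMod p → ℂ) (hu : ∀ v, ‖u v‖ ≤ 1) (hu0 : ∑ v, u v = 0)
    (S : Finset (ZMod p)) (hS : S.Nonempty) :
    ∃ c : ZMod p → ℂ, c 0 = 0 ∧ ∑ ξ, ‖c ξ‖ ≤ Real.sqrt (p / S.card) ∧
      ∀ y, (S.card : ℂ)⁻¹ * ∑ h ∈ S, u (y - h) = ∑ ξ, c ξ * ZMod.stdAddChar (ξ * y) := by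
  classical
  set i : ZMod p → ℂ := fun v => if v ∈ S then 1 else 0 with hi
  have hp : (0 : ℝ) < p := by exact_mod_cast NeZero.pos p
  have hc : (0 : ℝ) < S.card := by exact_mod_cast hS.card_pos
  -- Averaging over translates is a convolution, so coefficients multiply; Cauchy–Schwarz and
  -- Parseval bound their sum, and mean zero kills the constant term.
  refine ⟨fun ξ => (p : ℂ)⁻¹ * (S.card : ℂ)⁻¹ * (fourierCoeff u ξ * fourierCoeff i ξ), ?_, ?_,
    fun y => ?_⟩
  · simp [fourierCoeff, hu0]
  · have h1 : ∑ ξ, ‖fourierCoeff u ξ‖ ^ 2 ≤ p * p := by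
      rw [sum_norm_fourierCoeff_sq]
      gcongr
      calc ∑ v, ‖u v‖ ^ 2 ≤ ∑ _v : ZMod p, (1 : ℝ) :=
            Finset.sum_le_sum fun v _ => pow_le_one₀ (norm_nonneg _) (hu v)
        _ = p := by simp
    have h2 : ∑ ξ, ‖fourierCoeff i ξ‖ ^ 2 = p * S.card := by
      rw [sum_norm_fourierCoeff_sq]
      congr 1
      simp only [hi, apply_ite norm, norm_one, norm_zero, ite_pow, one_pow]
      simp
    calc _ = (p : ℝ)⁻¹ * (S.card : ℝ)⁻¹ * ∑ ξ, ‖fourierCoeff u ξ‖ * ‖fourierCoeff i ξ‖ := by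
          rw [Finset.mul_sum]
          simp only [norm_mul, norm_inv, Complex.norm_natCast]
      _ ≤ (p : ℝ)⁻¹ * (S.card : ℝ)⁻¹ * (Real.sqrt (p * p) * Real.sqrt (p * S.card)) := by
          gcongr
          refine (Real.sum_mul_le_sqrt_mul_sqrt _ _ _).trans ?_
          rw [h2]
          gcongr
      _ = _ := by
          rw [Real.sqrt_mul_self hp.le, Real.sqrt_mul hp.le, Real.sqrt_div hp.le]
          have h3 : Real.sqrt S.card * Real.sqrt S.card = S.card := Real.mul_self_sqrt hc.le
          have h4 : Real.sqrt S.card ≠ 0 := (Real.sqrt_pos.mpr hc).ne'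
          field_simp
          nlinarith
  · have h1 : ∀ ξ, fourierCoeff i ξ = ∑ h ∈ S, ZMod.stdAddChar (-(ξ * h)) := by
      intro ξ
      simp [fourierCoeff, hi]
    have h2 : ∀ ξ, (p : ℂ)⁻¹ * (S.card : ℂ)⁻¹ * (fourierCoeff u ξ * fourierCoeff i ξ) *
        ZMod.stdAddChar (ξ * y) = (S.card : ℂ)⁻¹ * ∑ h ∈ S,
          (p : ℂ)⁻¹ * (fourierCoeff u ξ * ZMod.stdAddChar (ξ * (y - h))) := by
      intro ξ
      rw [h1, ← Finset.mul_sum, ← Finset.mul_sum]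
      have h3 : ∑ h ∈ S, (ZMod.stdAddChar (ξ * (y - h)) : ℂ) =
          (∑ h ∈ S, ZMod.stdAddChar (-(ξ * h))) * ZMod.stdAddChar (ξ * y) := by
        rw [Finset.sum_mul]
        refine Finset.sum_congr rfl fun h _ => ?_
        rw [← AddChar.map_add_eq_mul]
        congr 1
        ring
      rw [h3]
      ring
    simp only [h2]
    rw [← Finset.mul_sum, Finset.sum_comm]
    congr 1
    refine Finset.sum_congr rfl fun h _ => ?_
    rw [← Finset.mul_sum, sum_fourierCoeff_mul, ← mul_assoc, inv_mul_cancel₀, one_mul]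
    exact_mod_cast hp.ne'

end Fourier

/-! ### Smoothing the indicator of an interval -/

section Interval

variable {p : ℕ} [NeZero p]

/-- The indicator function of `{0, …, ℓ - 1}` in `ℤ/pℤ`. -/
noncomputable def intervalIndicator (ℓ : ℕ) (y : ZMod p) : ℂ := if y.val < ℓ then 1 else 0

/-- A shift by one changes the indicator at most at the endpoints `0` and `ℓ`; the triangle
inequality handles `n` shifts. -/
lemma sum_norm_sub_shift_le (ℓ n : ℕ) :
    ∑ y : ZMod p, ‖intervalIndicator ℓ y - intervalIndicator ℓ (y - (n : ZMod p))‖ ≤ 2 * n := by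
  have hone : ∑ y : ZMod p, ‖intervalIndicator ℓ y - intervalIndicator ℓ (y - 1)‖ ≤ 2 := by
    calc _ ≤ ∑ y : ZMod p, ((if y = 0 then (1 : ℝ) else 0) + if y = (ℓ : ZMod p) then 1 else 0) := by
          refine Finset.sum_le_sum fun y _ => ?_
          have hb : ‖intervalIndicator ℓ y - intervalIndicator ℓ (y - 1)‖ ≤ 1 := by
            unfold intervalIndicator
            split_ifs <;> simp
          by_cases hy : y = 0
          · rw [if_pos hy]
            refine hb.trans (le_add_of_nonneg_right ?_)
            split_ifs <;> simp
          by_cases hy' : y = (ℓ : ZMod p)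
          · rw [if_pos hy']
            refine hb.trans (le_add_of_nonneg_left ?_)
            split_ifs <;> simp
          rw [if_neg hy, if_neg hy', add_zero]
          have h1 : y.val ≠ 0 := by rwa [Ne, ZMod.val_eq_zero]
          have h2 : y.val ≠ ℓ := by
            rintro h
            exact hy' (by rw [← h, ZMod.natCast_zmod_val])
          have h3 : (y - 1).val = y.val - 1 := by
            have h4 : (1 : ZMod p).val = 1 := ZMod.val_one'' (by
              rintro rfl
              exact hy (Subsingleton.elim _ _))
            rw [ZMod.val_sub (by omega), h4]
          unfold intervalIndicator
          rw [h3]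
          have h5 : y.val - 1 < ℓ ↔ y.val < ℓ := by omega
          simp only [h5, sub_self, norm_zero, le_refl]
      _ = 2 := by
          rw [Finset.sum_add_distrib]
          simp
          norm_num
  induction n with
  | zero => simp
  | succ n ih =>
    calc _ ≤ ∑ y : ZMod p, (‖intervalIndicator ℓ y - intervalIndicator ℓ (y - (n : ZMod p))‖ +
          ‖intervalIndicator ℓ (y - (n : ZMod p)) - intervalIndicator ℓ (y - (n : ZMod p) - 1)‖) := by
          refine Finset.sum_le_sum fun y _ => ?_
          rw [show y - ((n + 1 : ℕ) : ZMod p) = y - (n : ZMod p) - 1 by push_cast; ring]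
          exact norm_sub_le_norm_sub_add_norm_sub _ _ _
      _ = ∑ y : ZMod p, ‖intervalIndicator ℓ y - intervalIndicator ℓ (y - (n : ZMod p))‖ +
          ∑ y : ZMod p, ‖intervalIndicator ℓ y - intervalIndicator ℓ (y - 1)‖ := by
          rw [Finset.sum_add_distrib]
          congr 1
          exact Fintype.sum_equiv (Equiv.subRight (n : ZMod p)) _ _ fun _ => rfl
      _ ≤ _ := by push_cast; linarith

lemma card_filter_val_lt {ℓ : ℕ} (h : ℓ ≤ p) :
    (Finset.univ.filter fun y : ZMod p => y.val < ℓ).card = ℓ := by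
  have h1 : (Finset.univ.filter fun y : ZMod p => y.val < ℓ) =
      (Finset.range ℓ).image (Nat.cast : ℕ → ZMod p) := by
    ext y
    simp only [Finset.mem_filter, Finset.mem_univ, true_and, Finset.mem_image, Finset.mem_range]
    refine ⟨fun hy => ⟨y.val, hy, ZMod.natCast_zmod_val y⟩, ?_⟩
    rintro ⟨n, hn, rfl⟩
    rwa [ZMod.val_natCast_of_lt (by omega)]
  rw [h1, Finset.card_image_of_injOn, Finset.card_range]
  intro m hm n hn hmn
  have hm' := Finset.mem_range.mp (Finset.mem_coe.mp hm)
  have hn' := Finset.mem_range.mp (Finset.mem_coe.mp hn)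
  have := congrArg ZMod.val hmn
  rwa [ZMod.val_natCast_of_lt (by omega), ZMod.val_natCast_of_lt (by omega)] at this

/-- Decomposition of the balanced indicator function of an interval into a part with small
`L¹`-norm and a part with absolutely bounded Fourier series without constant term. -/
lemma exists_interval_decomposition {ℓ H : ℕ} (hℓ : ℓ ≤ p) (hH : 0 < H) (hHp : H ≤ p) :
    ∃ (c : ZMod p → ℂ) (Z : ZMod p → ℂ), c 0 = 0 ∧ ∑ ξ, ‖c ξ‖ ≤ Real.sqrt (p / H) ∧
      ∑ y, ‖Z y‖ ≤ 2 * H ∧ ∀ y, intervalIndicator ℓ y - (ℓ : ℂ) / p =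
        Z y + ∑ ξ, c ξ * ZMod.stdAddChar (ξ * y) := by
  have hp : 0 < p := NeZero.pos p
  have hpC : (p : ℂ) ≠ 0 := by exact_mod_cast hp.ne'
  set S : Finset (ZMod p) := Finset.univ.filter fun y => y.val < H with hS
  have hScard : S.card = H := card_filter_val_lt hHp
  have hHC : (H : ℂ) ≠ 0 := by exact_mod_cast hH.ne'
  set u : ZMod p → ℂ := fun y => intervalIndicator ℓ y - (ℓ : ℂ) / p with hu
  have hr : (0 : ℝ) ≤ (ℓ : ℝ) / p ∧ (ℓ : ℝ) / p ≤ 1 :=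
    ⟨by positivity, div_le_one_of_le₀ (by exact_mod_cast hℓ) (by positivity)⟩
  have hu1 : ∀ y, ‖u y‖ ≤ 1 := by
    intro y
    have h1 : u y = (((if y.val < ℓ then 1 else 0) - (ℓ : ℝ) / p : ℝ) : ℂ) := by
      simp only [hu, intervalIndicator]
      push_cast
      split_ifs <;> simp
    rw [h1, Complex.norm_real, Real.norm_eq_abs, abs_le]
    split_ifs <;> constructor <;> linarith [hr.1, hr.2]
  have hu0 : ∑ y, u y = 0 := by
    simp only [hu, Finset.sum_sub_distrib, intervalIndicator, Finset.sum_boole,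
      card_filter_val_lt hℓ, Finset.sum_const, Finset.card_univ, ZMod.card, nsmul_eq_mul]
    field_simp
    simp
  obtain ⟨c, hc0, hc1, hc⟩ := exists_fourier_average u hu1 hu0 S
    (Finset.card_pos.mp (by omega))
  rw [hScard] at hc1
  refine ⟨c, fun y => (H : ℂ)⁻¹ * ∑ h ∈ S, (u y - u (y - h)), hc0, hc1, ?_, fun y => ?_⟩
  · calc ∑ y, ‖(H : ℂ)⁻¹ * ∑ h ∈ S, (u y - u (y - h))‖
        ≤ ∑ y, (H : ℝ)⁻¹ * ∑ h ∈ S, ‖u y - u (y - h)‖ := by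
          refine Finset.sum_le_sum fun y _ => ?_
          rw [norm_mul, norm_inv, Complex.norm_natCast]
          gcongr
          exact norm_sum_le _ _
      _ = (H : ℝ)⁻¹ * ∑ h ∈ S, ∑ y, ‖u y - u (y - h)‖ := by
          rw [← Finset.mul_sum, Finset.sum_comm]
      _ ≤ (H : ℝ)⁻¹ * ∑ h ∈ S, (2 * H : ℝ) := by
          gcongr with h hh
          have h1 := sum_norm_sub_shift_le (p := p) ℓ h.val
          rw [ZMod.natCast_zmod_val] at h1
          simp only [hu, sub_sub_sub_cancel_right]
          refine h1.trans ?_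
          have : h.val < H := (Finset.mem_filter.mp hh).2
          have : (h.val : ℝ) ≤ H := by exact_mod_cast this.le
          linarith
      _ = 2 * H := by
          rw [Finset.sum_const, hScard, nsmul_eq_mul]
          have : (H : ℝ) ≠ 0 := by exact_mod_cast hH.ne'
          field_simp
  · have h1 : ∑ h ∈ S, (u y - u (y - h)) = H * u y - ∑ h ∈ S, u (y - h) := by
      rw [Finset.sum_sub_distrib (fun _ => u y), Finset.sum_const, hScard, nsmul_eq_mul]
    change u y = _
    beta_reduce
    rw [← hc y, hScard, h1, mul_sub, ← mul_assoc, inv_mul_cancel₀ hHC]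
    ring

end Interval

/-! ### Gowers uniformity of sets cut out by polynomial phases -/

section Uniformity

variable {p : ℕ} [Fact p.Prime]

/-- Over a field, `v ↦ v ^ s` takes each value at most `s` times. -/
lemma sum_pow_sub_le (s : ℕ) (hs : 0 < s) (u : ZMod p) {Z : ZMod p → ℝ} (hZ : ∀ y, 0 ≤ Z y) :
    ∑ v, Z (v ^ s - u) ≤ s * ∑ y, Z y := by
  classical
  have h1 := Finset.sum_comp (s := Finset.univ) Z fun v : ZMod p => v ^ s - u
  rw [h1, Finset.mul_sum]
  refine (Finset.sum_le_sum fun y _ => ?_).trans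
    (Finset.sum_le_sum_of_subset_of_nonneg (Finset.subset_univ _)
      fun y _ _ => mul_nonneg (Nat.cast_nonneg s) (hZ y))
  rw [nsmul_eq_mul]
  gcongr
  · exact hZ y
  · calc _ ≤ (Polynomial.nthRoots s (y + u)).toFinset.card := by
          refine Finset.card_le_card fun v hv => ?_
          rw [Multiset.mem_toFinset, Polynomial.mem_nthRoots hs]
          exact sub_eq_iff_eq_add.mp (Finset.mem_filter.mp hv).2
      _ ≤ _ := (Multiset.toFinset_card_le _).trans (Polynomial.card_nthRoots _ _)

variable {G : Type*} [AddCommGroup G] [Fintype G]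

/-- Along translates by multiples of `t` the shift `U` is constant while `π` runs through all of
`ZMod p`. -/
lemma expect_pow_sub_le (π : G →+ ZMod p) {t : G} (ht : π t ≠ 0) (s : ℕ) (hs : 0 < s)
    {U : G → ZMod p} (hU : ∀ x, U (x + t) = U x) {Z : ZMod p → ℝ} (hZ : ∀ y, 0 ≤ Z y) :
    𝔼 x, Z (π x ^ s - U x) ≤ s * ((∑ y, Z y) / p) := by
  have hUn : ∀ (n : ℕ) x, U (x + n • t) = U x := by
    intro n
    induction n with
    | zero => simp
    | succ n ih => intro x; rw [succ_nsmul, ← add_assoc, hU, ih]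
  have h1 : 𝔼 x, Z (π x ^ s - U x) = 𝔼 x, 𝔼 j : ZMod p, Z ((π x + j * π t) ^ s - U x) := by
    rw [Finset.expect_comm]
    have h2 : ∀ j : ZMod p, 𝔼 x, Z ((π x + j * π t) ^ s - U x) = 𝔼 x, Z (π x ^ s - U x) := by
      intro j
      rw [← expect_add_shift (fun x => Z (π x ^ s - U x)) (j.val • t)]
      refine Finset.expect_congr rfl fun x _ => ?_
      rw [hUn, map_add, map_nsmul, nsmul_eq_mul, ZMod.natCast_zmod_val]
    simp only [h2]
    rw [Fintype.expect_const]
  rw [h1]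
  have h3 : ∀ x, 𝔼 j : ZMod p, Z ((π x + j * π t) ^ s - U x) ≤ s * ((∑ y, Z y) / p) := by
    intro x
    have h4 : ∑ j : ZMod p, Z ((π x + j * π t) ^ s - U x) = ∑ v, Z (v ^ s - U x) :=
      Fintype.sum_equiv ((Equiv.mulRight₀ (π t) ht).trans (Equiv.addLeft (π x))) _ _ fun _ => rfl
    rw [Fintype.expect_eq_sum_div_card, h4, ZMod.card, ← mul_div_assoc]
    gcongr
    exact sum_pow_sub_le s hs _ hZ
  calc _ ≤ 𝔼 _x : G, s * ((∑ y, Z y) / (p : ℝ)) := Finset.expect_le_expect fun x _ => h3 x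
    _ = _ := Fintype.expect_const _

/-- Sets cut out by a polynomial phase of degree `s + 1`, shifted by a function independent of the
`ℤ/pℤ`-direction, are uniform. -/
lemma norm_gowersAverage_le (π : G →+ ZMod p) {t : G} (ht : π t ≠ 0) {s : ℕ} (hs : s + 1 < p)
    {U : G → ZMod p} (hU : ∀ x, U (x + t) = U x) {α : ℝ} (hα : 0 ≤ α) (hα1 : α ≤ 1)
    {ℓ H : ℕ} (hℓ : ℓ ≤ p) (hH : 0 < H) (hHp : H ≤ p) {f : G → ℂ}
    (hf : ∀ x, f x = intervalIndicator ℓ (π x ^ (s + 1) - U x) - α) :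
    ‖𝔼 n, 𝔼 h : Fin (s + 1) → G, iterMulDeriv h f n‖ ≤
      |(ℓ : ℝ) / p - α| + (s + 1 : ℕ) * (2 * H / p) + Real.sqrt (p / H) * phaseBound p s := by
  have hf1 : ∀ x, ‖f x‖ ≤ 1 := by
    intro x
    have h1 : f x = (((if (π x ^ (s + 1) - U x).val < ℓ then 1 else 0) - α : ℝ) : ℂ) := by
      rw [hf, intervalIndicator]
      push_cast
      split_ifs <;> simp
    rw [h1, Complex.norm_real, Real.norm_eq_abs, abs_le]
    split_ifs <;> constructor <;> linarith
  obtain ⟨Ψ, hΨ, hΨf⟩ := exists_cubeWeight hf1 (s + 1)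
  obtain ⟨c, Z, hc0, hc1, hZ1, hdec⟩ := exists_interval_decomposition hℓ hH hHp
  simp only [hΨf]
  -- Three sources of error: the rounding of the density, the part of the interval small in `L¹`,
  -- and the Fourier series, whose terms are phases with the `t`-invariant weight coming from `U`.
  have hsplit : 𝔼 x, 𝔼 h, f x * Ψ x h =
      𝔼 x, 𝔼 h, (((ℓ : ℝ) / p - α : ℝ) : ℂ) * Ψ x h +
      𝔼 x, 𝔼 h, Z (π x ^ (s + 1) - U x) * Ψ x h +
      ∑ ξ, c ξ * 𝔼 x, 𝔼 h, ZMod.stdAddChar (-(ξ * U x)) *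
        ZMod.stdAddChar (ξ * π x ^ (s + 1)) * Ψ x h := by
    simp only [Finset.mul_expect, ← Finset.expect_sum_comm, ← Finset.expect_add_distrib]
    refine Finset.expect_congr rfl fun x _ => Finset.expect_congr rfl fun h _ => ?_
    have h1 : f x = (((ℓ : ℝ) / p - α : ℝ) : ℂ) + Z (π x ^ (s + 1) - U x) +
        ∑ ξ, c ξ * ZMod.stdAddChar (ξ * (π x ^ (s + 1) - U x)) := by
      have := hdec (π x ^ (s + 1) - U x)
      rw [hf]
      push_cast
      linear_combination this
    rw [h1, add_mul, add_mul, Finset.sum_mul]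
    congr 1
    refine Finset.sum_congr rfl fun ξ _ => ?_
    rw [show ξ * (π x ^ (s + 1) - U x) = -(ξ * U x) + ξ * π x ^ (s + 1) by ring,
      AddChar.map_add_eq_mul]
    ring
  rw [hsplit]
  refine (norm_add_le _ _).trans (add_le_add ((norm_add_le _ _).trans (add_le_add ?_ ?_)) ?_)
  · refine norm_expect_le_of_forall (abs_nonneg _) fun x =>
      norm_expect_le_of_forall (abs_nonneg _) fun h => ?_
    rw [norm_mul, Complex.norm_real, Real.norm_eq_abs]
    exact mul_le_of_le_one_right (abs_nonneg _) (hΨ.norm_le _ _)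
  · calc _ ≤ 𝔼 x, ‖Z (π x ^ (s + 1) - U x)‖ := by
          refine (norm_expect_le _).trans (Finset.expect_le_expect fun x _ => ?_)
          refine norm_expect_le_of_forall (norm_nonneg _) fun h => ?_
          rw [norm_mul]
          exact mul_le_of_le_one_right (norm_nonneg _) (hΨ.norm_le _ _)
      _ ≤ (s + 1 : ℕ) * ((∑ y, ‖Z y‖) / p) :=
          expect_pow_sub_le π ht (s + 1) s.succ_pos hU fun y => norm_nonneg (Z y)
      _ ≤ _ := by gcongr
  · calc _ ≤ ∑ ξ, ‖c ξ‖ * phaseBound p s := by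
          refine (norm_sum_le _ _).trans (Finset.sum_le_sum fun ξ _ => ?_)
          rw [norm_mul]
          by_cases hξ : ξ = 0
          · rw [hξ, hc0]; simp
          gcongr
          exact norm_phaseAverage_le π ht s (isPhase_const_mul_pow s hs hξ)
            (fun x => (AddChar.norm_apply _ _).le) (fun x => by rw [hU]) hΨ
      _ ≤ _ := by
          rw [← Finset.sum_mul]
          exact mul_le_mul_of_nonneg_right hc1 (phaseBound_nonneg p s)

lemma gowersNorm_le_of_norm_le {s : ℕ} {f : G → ℂ} {η : ℝ} (hη : 0 ≤ η)
    (h : ‖𝔼 n, 𝔼 h : Fin s → G, iterMulDeriv h f n‖ ≤ η ^ (2 ^ s)) : gowersNorm s f ≤ η := by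
  unfold gowersNorm
  refine (le_abs_self _).trans ((Real.abs_rpow_le_abs_rpow _ _).trans ?_)
  calc _ ≤ (η ^ (2 ^ s)) ^ ((1 : ℝ) / 2 ^ s) := by
        refine Real.rpow_le_rpow (abs_nonneg _) ((Complex.abs_re_le_norm _).trans h) (by positivity)
    _ = η := by
        rw [← Real.rpow_natCast, ← Real.rpow_mul hη]
        push_cast
        rw [mul_one_div_cancel (by positivity), Real.rpow_one]

/-- For large `p` the quantity bounding the Gowers norm is as small as we please. -/
lemma exists_uniformity_threshold (s : ℕ) {α : ℝ} (hα : 0 ≤ α) {η : ℝ} (hη : 0 < η) :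
    ∃ p₀ : ℕ, ∀ p : ℕ, p₀ ≤ p → ∃ H : ℕ, 0 < H ∧ H ≤ p ∧
      |(⌊α * p⌋₊ : ℝ) / p - α| + (s + 1 : ℕ) * (2 * H / p) +
        Real.sqrt (p / H) * phaseBound p s ≤ η := by
  -- With `H` about `γ p` the `L¹` error is at most a fixed fraction of `η`, while `p / H` stays
  -- bounded by `2 / γ`, so `phaseBound` still wins as `p` grows.
  set γ : ℝ := min 1 (η / (6 * (s + 1 : ℕ))) with hγ
  have hγ0 : 0 < γ := lt_min one_pos (by positivity)
  have hγ1 : γ ≤ 1 := min_le_left _ _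
  have hγ2 : γ * (6 * (s + 1 : ℕ)) ≤ η := by
    rw [← le_div_iff₀ (by positivity)]; exact min_le_right _ _
  have htend : Filter.Tendsto (fun p : ℕ => (p : ℝ)⁻¹ + Real.sqrt (2 / γ) * phaseBound p s)
      Filter.atTop (nhds 0) := by
    have := (tendsto_inv_atTop_nhds_zero_nat (𝕜 := ℝ)).add
      ((tendsto_phaseBound s).const_mul (Real.sqrt (2 / γ)))
    simpa using this
  obtain ⟨p₀, hp₀⟩ := Filter.eventually_atTop.mp
    (htend.eventually_lt_const (show (0 : ℝ) < η / 2 by positivity))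
  obtain ⟨p₁, hp₁⟩ := exists_nat_ge (2 / γ)
  refine ⟨max p₀ (p₁ + 1), fun p hp => ?_⟩
  have hpos : 0 < p := by have := (le_max_right _ _).trans hp; omega
  have hpr : (0 : ℝ) < p := by exact_mod_cast hpos
  have h1 := hp₀ p ((le_max_left _ _).trans hp)
  have h2 : 2 ≤ γ * p := by
    have h3 : (p₁ : ℝ) ≤ p := by
      have := (le_max_right _ _).trans hp
      exact_mod_cast (by omega : p₁ ≤ p)
    rw [div_le_iff₀ hγ0] at hp₁
    nlinarith
  set H : ℕ := ⌊γ * p⌋₊ with hH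
  have hHle : (H : ℝ) ≤ γ * p := Nat.floor_le (by positivity)
  have hHge : γ * p / 2 ≤ H := by
    have := Nat.lt_floor_add_one (γ * p)
    rw [← hH] at this
    linarith
  have hH0 : (0 : ℝ) < H := by linarith
  refine ⟨H, by exact_mod_cast hH0, ?_, ?_⟩
  · have : (H : ℝ) ≤ p := hHle.trans (by nlinarith)
    exact_mod_cast this
  · have e1 : |(⌊α * p⌋₊ : ℝ) / p - α| ≤ (p : ℝ)⁻¹ := by
      have ha := Nat.floor_le (show 0 ≤ α * p by positivity)
      have hb := Nat.lt_floor_add_one (α * p)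
      have : (⌊α * p⌋₊ : ℝ) / p - α = (⌊α * p⌋₊ - α * p) / p := by field_simp
      rw [this, abs_div, abs_of_pos hpr, inv_eq_one_div]
      gcongr
      rw [abs_le]
      constructor <;> linarith
    have e2 : ((s + 1 : ℕ) : ℝ) * (2 * H / p) ≤ η / 2 := by
      have : 2 * (H : ℝ) / p ≤ 2 * γ := by
        rw [div_le_iff₀ hpr]; linarith
      calc ((s + 1 : ℕ) : ℝ) * (2 * H / p) ≤ (s + 1 : ℕ) * (2 * γ) := by gcongr
        _ ≤ η / 2 := by linarith
    have e3 : Real.sqrt (p / H) * phaseBound p s ≤ Real.sqrt (2 / γ) * phaseBound p s := by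
      refine mul_le_mul_of_nonneg_right (Real.sqrt_le_sqrt ?_) (phaseBound_nonneg p s)
      rw [div_le_div_iff₀ hH0 hγ0]
      linarith
    linarith

end Uniformity

/-! ### A linear relation along progressions -/

section Relation

/-- A linear relation with nonzero coefficients among the values of a polynomial of degree `k - 2`
at `k` points. -/
lemma exists_relation {k : ℕ} (hk : 2 ≤ k) {a : Fin k → ℤ} (ha : Function.Injective a) :
    ∃ C : Fin k → ℤ, (∀ i, C i ≠ 0) ∧ ∀ n d : ℤ, ∑ i, C i * (n + a i * d) ^ (k - 2) = 0 := by
  set w : Fin k → ℤ := fun i => ∏ j ∈ Finset.univ.erase i, (a i - a j) with hw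
  have hw0 : ∀ i, w i ≠ 0 := fun i => Finset.prod_ne_zero_iff.mpr fun j hj =>
    sub_ne_zero.mpr fun h => Finset.ne_of_mem_erase hj (ha h).symm
  -- The coefficients `1 / w i` of the divided difference of order `k - 1`, which kills degree `k -
  -- 2`, with denominators cleared.
  refine ⟨fun i => ∏ l ∈ Finset.univ.erase i, w l,
    fun i => Finset.prod_ne_zero_iff.mpr fun l _ => hw0 l, fun n d => ?_⟩
  have hwQ : ∀ i, (w i : ℚ) ≠ 0 := fun i => by exact_mod_cast hw0 i
  set P : Polynomial ℚ := (Polynomial.C (d : ℚ) * Polynomial.X + Polynomial.C (n : ℚ)) ^ (k - 2)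
    with hP
  have hdeg : P.natDegree ≤ k - 2 := by
    refine Polynomial.natDegree_pow_le.trans ?_
    exact (Nat.mul_le_mul_left _ Polynomial.natDegree_linear_le).trans (by omega)
  have hcoeff : P.coeff (k - 1) = 0 := Polynomial.coeff_eq_zero_of_natDegree_lt (by omega)
  have hinj : Set.InjOn (fun i : Fin k => (a i : ℚ)) (Finset.univ : Finset (Fin k)) :=
    fun i _ j _ h => ha (Int.cast_injective h)
  have hlag := Lagrange.coeff_eq_sum hinj (P := P) (by
    rw [Finset.card_univ, Fintype.card_fin]
    refine lt_of_le_of_lt Polynomial.degree_le_natDegree ?_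
    exact_mod_cast (by omega : P.natDegree < k))
  rw [Finset.card_univ, Fintype.card_fin, hcoeff] at hlag
  have hQ : ((∑ i, (∏ l ∈ Finset.univ.erase i, w l) * (n + a i * d) ^ (k - 2) : ℤ) : ℚ) = 0 := by
    calc _ = (∏ l, (w l : ℚ)) * ∑ i, Polynomial.eval (a i : ℚ) P /
          ∏ j ∈ Finset.univ.erase i, ((a i : ℚ) - a j) := by
          rw [Finset.mul_sum]
          push_cast
          refine Finset.sum_congr rfl fun i _ => ?_
          rw [← Finset.mul_prod_erase Finset.univ (fun l => (w l : ℚ)) (Finset.mem_univ i)]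
          have h1 : ∏ j ∈ Finset.univ.erase i, ((a i : ℚ) - a j) = w i := by
            simp only [hw]; push_cast; rfl
          rw [h1, hP]
          simp only [Polynomial.eval_pow, Polynomial.eval_add, Polynomial.eval_mul,
            Polynomial.eval_C, Polynomial.eval_X]
          field_simp [hwQ i]
          ring
      _ = 0 := by rw [← hlag, mul_zero]
  exact_mod_cast hQ

end Relation

/-! ### Generic shifts by a union bound -/

section Shift

/-- Generic shifts avoid approximate solutions of a linear equation for all color patterns in which
some color occurs exactly once. -/
lemma exists_shift {k : ℕ} {p : ℕ} [Fact p.Prime] (C : Fin k → ℤ)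
    (hC : ∀ i, (C i : ZMod p) ≠ 0) {κ : Type*} [Fintype κ] (m : ℕ)
    (hm : Fintype.card κ ^ k * (2 * m + 1) < p) :
    ∃ U : κ → ZMod p, ∀ ι : Fin k → κ, (∃ i, ∀ l, l ≠ i → ι l ≠ ι i) →
      ∀ e : ℤ, |e| ≤ m → ∑ i, (C i : ZMod p) * U (ι i) ≠ e := by
  classical
  by_contra! hall
  let π : (Fin k → κ) → (κ → ZMod p) →+ ZMod p := fun ι =>
    { toFun := fun U => ∑ i, (C i : ZMod p) * U (ι i)
      map_zero' := by simp
      map_add' := fun U V => by simp [mul_add, Finset.sum_add_distrib] }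
  set I := Finset.univ.filter fun ι : Fin k → κ => ∃ i, ∀ l, l ≠ i → ι l ≠ ι i with hI
  set J := Finset.Icc (-(m : ℤ)) m with hJ
  have hsurj : ∀ ι ∈ I, Function.Surjective (π ι) := by
    intro ι hι y
    obtain ⟨i, hi⟩ := (Finset.mem_filter.mp hι).2
    -- Since this color occurs only at index `i`, changing `U` at it alone reaches every value;
    -- hence each condition holds for exactly a `1/p` fraction of the `U`.
    refine ⟨Pi.single (ι i) (y / C i), ?_⟩
    change ∑ l, (C l : ZMod p) * (Pi.single (ι i) (y / (C i : ZMod p)) : κ → ZMod p) (ι l) = y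
    rw [Finset.sum_eq_single i]
    · rw [Pi.single_eq_same, mul_div_cancel₀ _ (hC i)]
    · intro l _ hl
      rw [Pi.single_eq_of_ne (hi l hl), mul_zero]
    · simp
  have hcover : (Finset.univ : Finset (κ → ZMod p)) ⊆ (I ×ˢ J).biUnion fun x =>
      Finset.univ.filter fun U => π x.1 U = (x.2 : ZMod p) := by
    intro U _
    obtain ⟨ι, hι, e, he, h⟩ := hall U
    rw [abs_le] at he
    simp only [Finset.mem_biUnion, Finset.mem_filter, Finset.mem_univ, true_and]
    exact ⟨(ι, e), Finset.mem_product.mpr ⟨Finset.mem_filter.mpr ⟨Finset.mem_univ _, hι⟩,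
      Finset.mem_Icc.mpr he⟩, h⟩
  have hcard := (Finset.card_le_card hcover).trans Finset.card_biUnion_le
  rw [Finset.card_univ] at hcard
  have hIJ : (I ×ˢ J).card ≤ Fintype.card κ ^ k * (2 * m + 1) := by
    rw [Finset.card_product]
    refine Nat.mul_le_mul ?_ ?_
    · calc I.card ≤ Fintype.card (Fin k → κ) := Finset.card_le_univ _
        _ = _ := by simp
    · rw [hJ, Int.card_Icc]; omega
  have hpos : 0 < Fintype.card (κ → ZMod p) := Fintype.card_pos
  have hfinal : p * Fintype.card (κ → ZMod p) ≤
      Fintype.card κ ^ k * (2 * m + 1) * Fintype.card (κ → ZMod p) := by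
    calc p * Fintype.card (κ → ZMod p)
        ≤ p * ∑ x ∈ I ×ˢ J, (Finset.univ.filter fun U => π x.1 U = (x.2 : ZMod p)).card := by
          gcongr
      _ = ∑ x ∈ I ×ˢ J, Fintype.card (κ → ZMod p) := by
          rw [Finset.mul_sum]
          refine Finset.sum_congr rfl fun x hx => ?_
          have := card_eq_card_mul_card_fiber (π x.1)
            (hsurj _ (Finset.mem_product.mp hx).1) (x.2 : ZMod p)
          rw [this, ZMod.card]
      _ = (I ×ˢ J).card * Fintype.card (κ → ZMod p) := by rw [Finset.sum_const, smul_eq_mul]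
      _ ≤ _ := by gcongr
  exact absurd (Nat.le_of_mul_le_mul_right hfinal hpos) (not_le.mpr hm)

end Shift

/-! ### The uniform sets with few progressions -/

section Construction

/-- From a coloring of a cyclic group in which nondegenerate `a`-APs have a point whose color is not
repeated, one obtains uniform sets with few `a`-APs. -/
lemma exists_uniform_set {k : ℕ} (hk : 4 ≤ k) {a : Fin k → ℤ} {C : Fin k → ℤ}
    (hC0 : ∀ i, C i ≠ 0) (hC : ∀ n d : ℤ, ∑ i, C i * (n + a i * d) ^ (k - 2) = 0)
    {α : ℝ} (hα : 0 < α) (hα1 : α < 1) {M Q : ℕ} (hM : 0 < M) (hQ : 0 < Q)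
    {κ : Type} [Fintype κ]
    (hκ : (Fintype.card κ : ℝ) ^ k * (4 * ∑ i, (C i).natAbs : ℕ) * α < 1)
    (col : ZMod (M * Q) → κ) (hcol : ∀ n d : ZMod (M * Q),
      ZMod.castHom (Dvd.intro _ rfl) (ZMod M) d ≠ 0 →
      ZMod.castHom (Dvd.intro_left M rfl) (ZMod Q) d ≠ 0 →
      ∃ i, ∀ l, l ≠ i → col (n + a l • d) ≠ col (n + a i • d))
    {η : ℝ} (hη : 0 < η) (N₀ : ℕ) :
    ∃ (N : ℕ) (_ : NeZero N), N₀ ≤ N ∧ ∃ A : Set (ZMod N),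
      gowersNorm (k - 2) (fun n => A.indicator (fun _ => (1 : ℂ)) n - (α : ℂ)) ≤ η ∧
      Lambda a (fun _ => A.indicator (fun _ => (1 : ℝ))) ≤ (M : ℝ)⁻¹ + (Q : ℝ)⁻¹ := by
  classical
  obtain ⟨s, hks⟩ : ∃ s, k - 2 = s + 1 := ⟨k - 3, by omega⟩
  rw [hks] at hC ⊢
  set K : ℕ := ∑ i, (C i).natAbs with hK
  obtain ⟨p₀, hp₀⟩ := exists_uniformity_threshold s hα.le
    (show (0 : ℝ) < η ^ (2 ^ (s + 1)) by positivity)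
  obtain ⟨p, hple, hprime⟩ := Nat.exists_infinite_primes
    (N₀ + p₀ + k + M * Q + K + 2 * Fintype.card κ ^ k + 1)
  have hp : Fact p.Prime := ⟨hprime⟩
  have hMQ : 0 < M * Q := Nat.mul_pos hM hQ
  have : NeZero M := ⟨hM.ne'⟩
  have : NeZero Q := ⟨hQ.ne'⟩
  have hN : NeZero (M * Q * p) := ⟨(Nat.mul_pos hMQ hprime.pos).ne'⟩
  have hpr : (0 : ℝ) < p := by exact_mod_cast hprime.pos
  set ℓ : ℕ := ⌊α * p⌋₊ with hℓ
  have hℓr : (ℓ : ℝ) ≤ α * p := Nat.floor_le (by positivity)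
  have hℓp : ℓ ≤ p := by
    have : (ℓ : ℝ) ≤ p := hℓr.trans (by nlinarith)
    exact_mod_cast this
  obtain ⟨H, hH, hHp, hbound⟩ := hp₀ p (by omega)
  have hCp : ∀ i, (C i : ZMod p) ≠ 0 := by
    intro i h
    rw [ZMod.intCast_zmod_eq_zero_iff_dvd] at h
    have h1 := Nat.le_of_dvd (Int.natAbs_pos.mpr (hC0 i)) (Int.natCast_dvd.mp h : p ∣ (C i).natAbs)
    have h2 : (C i).natAbs ≤ K :=
      Finset.single_le_sum (f := fun i => (C i).natAbs) (fun _ _ => Nat.zero_le _)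
        (Finset.mem_univ i)
    omega
  -- Here `m = K * ℓ` with `ℓ ≤ α p`: the term `2m` uses up less than `p / 2` by the hypothesis on
  -- the colors, and the term `1` less than `p / 2` by the choice of `p`.
  obtain ⟨V, hV⟩ := exists_shift C hCp (κ := κ) (K * ℓ) (by
    have h1 : (2 * Fintype.card κ ^ k : ℝ) < p := by
      exact_mod_cast (by omega : 2 * Fintype.card κ ^ k < p)
    have h2 : (Fintype.card κ : ℝ) ^ k * (2 * (K * ℓ) + 1) < p := by
      have h3 : (Fintype.card κ : ℝ) ^ k * (K * ℓ) ≤ (Fintype.card κ : ℝ) ^ k * (K * (α * p)) := by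
        gcongr
      have h4 : (Fintype.card κ : ℝ) ^ k * (4 * K) * α * p < 1 * p := by
        rw [Nat.cast_mul, Nat.cast_ofNat] at hκ
        gcongr
      nlinarith
    exact_mod_cast h2)
  let π : ZMod (M * Q * p) →+* ZMod p := ZMod.castHom (Dvd.intro_left (M * Q) rfl) (ZMod p)
  let τ : ZMod (M * Q * p) →+* ZMod (M * Q) := ZMod.castHom (Dvd.intro _ rfl) (ZMod (M * Q))
  let μ : ZMod (M * Q) →+* ZMod M := ZMod.castHom (Dvd.intro _ rfl) (ZMod M)
  let ν : ZMod (M * Q) →+* ZMod Q := ZMod.castHom (Dvd.intro_left M rfl) (ZMod Q)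
  set U : ZMod (M * Q * p) → ZMod p := fun x => V (col (τ x)) with hU
  -- This translation preserves colors but moves the residue modulo `p`, because `p > M * Q`.
  set t : ZMod (M * Q * p) := ((M * Q : ℕ) : ZMod (M * Q * p)) with ht
  have htτ : τ t = 0 := by rw [ht, map_natCast, ZMod.natCast_self]
  have htπ : π t ≠ 0 := by
    rw [ht, map_natCast, Ne, ZMod.natCast_eq_zero_iff]
    exact fun h => absurd (Nat.le_of_dvd hMQ h) (by omega)
  set A : Set (ZMod (M * Q * p)) := {x | (π x ^ (s + 1) - U x).val < ℓ} with hA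
  refine ⟨M * Q * p, hN, ?_, A, ?_, ?_⟩
  · have := Nat.le_mul_of_pos_left p hMQ
    omega
  · refine gowersNorm_le_of_norm_le hη.le (le_trans ?_ hbound)
    refine norm_gowersAverage_le π.toAddMonoidHom (t := t) htπ (by omega) (U := U)
      (fun x => by simp only [hU, map_add, htτ, add_zero]) hα.le hα1.le hℓp hH hHp fun x => ?_
    congr 1
    simp only [Set.indicator, intervalIndicator, hA, Set.mem_ofPred_eq]
    rfl
  · have hpoint : ∀ n d : ZMod (M * Q * p),
        ∏ i, A.indicator (fun _ => (1 : ℝ)) (n + a i • d) ≤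
          (if μ (τ d) = 0 then (1 : ℝ) else 0) + if ν (τ d) = 0 then (1 : ℝ) else 0 := by
      intro n d
      have hle : ∏ i, A.indicator (fun _ => (1 : ℝ)) (n + a i • d) ≤ 1 :=
        Finset.prod_le_one (fun i _ => Set.indicator_nonneg (fun _ _ => zero_le_one) _)
          fun i _ => Set.indicator_le_self' (fun _ _ => zero_le_one) _
      by_cases hμ : μ (τ d) = 0
      · rw [if_pos hμ]
        refine hle.trans (le_add_of_nonneg_right ?_)
        split_ifs <;> simp
      by_cases hν : ν (τ d) = 0
      · rw [if_pos hν]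
        refine hle.trans (le_add_of_nonneg_left ?_)
        split_ifs <;> simp
      rw [if_neg hμ, if_neg hν, add_zero]
      by_cases hmem : ∀ i, n + a i • d ∈ A
      · exfalso
        obtain ⟨i₀, hi₀⟩ := hcol (τ n) (τ d) hμ hν
        obtain ⟨n', hn'⟩ := ZMod.intCast_surjective (π n)
        obtain ⟨d', hd'⟩ := ZMod.intCast_surjective (π d)
        set v : Fin k → ℕ := fun i => (π (n + a i • d) ^ (s + 1) - U (n + a i • d)).val with hv
        have hvcast : ∀ i, (v i : ZMod p) =
            ((n' + a i * d' : ℤ) : ZMod p) ^ (s + 1) - V (col (τ n + a i • τ d)) := by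
          intro i
          simp only [hv, hU]
          rw [ZMod.natCast_zmod_val]
          simp only [map_add, map_mul, map_intCast, ← hn', ← hd', zsmul_eq_mul]
          push_cast
          rfl
        -- The relation cancels the powers, leaving the combination of shifts equal to minus that of
        -- the offsets `v i < ℓ`, which is at most `K * ℓ` in size.
        refine hV (fun i => col (τ n + a i • τ d)) ⟨i₀, hi₀⟩ (-∑ i, C i * v i) ?_ ?_
        · rw [abs_neg]
          refine (Finset.abs_sum_le_sum_abs _ _).trans ?_
          rw [hK]
          push_cast
          rw [Finset.sum_mul]
          refine Finset.sum_le_sum fun i _ => ?_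
          rw [abs_mul, Nat.abs_cast]
          have h1 : v i < ℓ := hmem i
          gcongr
        · have h1 := congrArg (Int.cast : ℤ → ZMod p) (hC n' d')
          push_cast at h1 ⊢
          have h2 : ∑ i, (C i : ZMod p) * v i = ∑ i, (C i : ZMod p) * (n' + a i * d') ^ (s + 1) -
              ∑ i, (C i : ZMod p) * V (col (τ n + a i • τ d)) := by
            rw [← Finset.sum_sub_distrib]
            refine Finset.sum_congr rfl fun i _ => ?_
            rw [hvcast]
            push_cast
            ring
          rw [h2, h1]
          ring
      · push Not at hmem
        obtain ⟨i, hi⟩ := hmem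
        exact (Finset.prod_eq_zero (Finset.mem_univ i) (Set.indicator_of_notMem hi _)).le
    have hτ : Function.Surjective τ := ZMod.castHom_surjective _
    have hμs : Function.Surjective μ := ZMod.castHom_surjective _
    have hνs : Function.Surjective ν := ZMod.castHom_surjective _
    have hμ := expect_ite_map_eq_zero (μ.comp τ).toAddMonoidHom
      (hμs.comp hτ)
    have hν := expect_ite_map_eq_zero (ν.comp τ).toAddMonoidHom
      (hνs.comp hτ)
    rw [ZMod.card] at hμ hν
    rw [← hμ, ← hν, ← Finset.expect_add_distrib]
    unfold Lambda
    calc _ ≤ 𝔼 _n : ZMod (M * Q * p), 𝔼 d : ZMod (M * Q * p),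
          ((if μ (τ d) = 0 then (1 : ℝ) else 0) + if ν (τ d) = 0 then (1 : ℝ) else 0) :=
          Finset.expect_le_expect fun n _ => Finset.expect_le_expect fun d _ => hpoint n d
      _ = _ := Fintype.expect_const _

lemma Lambda_indicator_nonneg {k N : ℕ} [NeZero N] (a : Fin k → ℤ) (A : Set (ZMod N)) :
    0 ≤ Lambda a (fun _ => A.indicator (fun _ => (1 : ℝ))) :=
  Finset.expect_nonneg fun _ _ => Finset.expect_nonneg fun _ _ =>
    Finset.prod_nonneg fun _ _ => Set.indicator_nonneg (fun _ _ => zero_le_one) _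

/-- The supremum of the admissible numbers is admissible. -/
lemma isGreatest_rho {k : ℕ} {a : Fin k → ℤ} {α : ℝ} (h : BddAbove (admissible a α)) :
    IsGreatest (admissible a α) (rho a α) := by
  have hne : (admissible a α).Nonempty := ⟨0, fun ε hε => ⟨1, one_pos, 0, fun N _ _ A _ => by
    have := Lambda_indicator_nonneg a A
    linarith⟩⟩
  refine ⟨fun ε hε => ?_, fun ρ hρ => le_csSup h hρ⟩
  -- Half of `ε` is spent approximating the supremum and half on admissibility.
  obtain ⟨ρ, hρ, hlt⟩ := exists_lt_of_lt_csSup hne (show rho a α - ε / 2 < sSup (admissible a α) by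
    rw [rho]; linarith)
  obtain ⟨η, hη, N₀, hN⟩ := hρ (ε / 2) (by linarith)
  refine ⟨η, hη, N₀, fun N _ hN₀ A hA => ?_⟩
  have := hN N hN₀ A hA
  linarith

end Construction

end APDensity

theorem mainTheorem7 (k : ℕ) (hk : 4 ≤ k) (hk_even : Even k) (a : Fin k → ℤ)
    (ha : StrictMono a) (ha_symm : APDensity.IsSymmetric a)
    (hcol : APDensity.HasFewColorings a) :
    ∀ C : ℝ, 0 < C → ∃ α₀ : ℝ, 0 < α₀ ∧ α₀ < 1 ∧ ∀ α : ℝ, 0 < α → α < α₀ →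
      IsGreatest (APDensity.admissible a α) (APDensity.rho a α) ∧
      APDensity.rho a α < α ^ C := by
  intro C hC
  obtain ⟨c, hc0, hc⟩ := APDensity.exists_relation (by omega) ha.injective
  obtain ⟨α₀, hα₀, hα₀1, hparam⟩ := APDensity.exists_coloring_of_density (by omega) ha ha_symm hcol
    ⌈C⌉₊ (Nat.ceil_pos.mpr hC) (4 * ∑ i, (c i).natAbs)
  refine ⟨α₀, hα₀, hα₀1, fun α hα hαlt => ?_⟩
  obtain ⟨M, Q, hM, hQ, hMQ, κ, _, hκ, col, hcolp⟩ := hparam α hα hαlt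
  -- The exponent is rounded up to a natural number, and the factor `1/2` later makes the inequality
  -- strict.
  have hub : ∀ ρ ∈ APDensity.admissible a α, ρ ≤ α ^ ⌈C⌉₊ / 2 := by
    intro ρ hρ
    refine le_of_forall_pos_le_add fun ε hε => ?_
    obtain ⟨η, hη, N₀, hN⟩ := hρ ε hε
    obtain ⟨N, _, hN₀, A, hA, hΛ⟩ := APDensity.exists_uniform_set hk hc0 hc hα
      (hαlt.trans hα₀1) hM hQ hκ col hcolp hη N₀
    have := hN N hN₀ A hA
    linarith
  have hgreat := APDensity.isGreatest_rho ⟨_, hub⟩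
  refine ⟨hgreat, (hub _ hgreat.1).trans_lt ?_⟩
  have hpow : α ^ ⌈C⌉₊ ≤ α ^ C := by
    rw [← Real.rpow_natCast]
    exact Real.rpow_le_rpow_of_exponent_ge hα (hαlt.trans hα₀1).le (Nat.le_ceil C)
  have hpos : 0 < α ^ ⌈C⌉₊ := by positivity
  linarith
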